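/- A permutation of order $n$ is a bijection $\Pi:\{1,\dots,n\}\to\{1,\dots,n\}$; write $|\Pi|=n$. A set $A=\{a_1<\cdots<a_k\}\subseteq\{1,\dots,n\}$ induces in $\Pi$ the unique permutation $\pi$ of order $k$ such that $\pi(i)<\pi(j)$ if and only if $\Pi(a_i)<\Pi(a_j)$. For permutations $\pi$ of order $k$ and $\Pi$ of order $n$, the density $d(\pi,\Pi)$ is the probability that a uniformly random $k$-element subset of $\{1,\dots,n\}$ induces $\pi$ in $\Pi$; if $k>n$, set $d(\pi,\Pi)=0$. A sequence $(\Pi_i)_{i\in\mathbb N}$ of permutations is quasirandom if $\lim_{i\to\infty} d(\pi,\Pi_i)=1/|\pi|!$ for every permutation $\pi$. A set $S$ of permutations is forcing if every sequence $(\Pi_i)_{i\in\mathbb N}$ of permutations with $\lim_{i\to\infty} d(\pi,\Pi_i)=1/|\pi|!$ for all $\pi\in S$ is quasirandom. Theorem. Every forcing set of permutations (of arbitrary, possibly different, orders) has at least four elements. -/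

import Mathlib

/-- A permutation of some order: a pair of the order `n` and a bijection of the `n`-element linearly
ordered set `Fin n` onto itself. -/
abbrev FinPerm : Type := Σ n : ℕ, Equiv.Perm (Fin n)

namespace FinPerm

/-- The order of a permutation. -/
def order (p : FinPerm) : ℕ := p.1

/-- The set `A` of positions `a₁ < ⋯ < aₖ` induces `p` as a subpermutation of `P`: it has as many
elements as the order of `p`, and `p i < p j` if and only if `P aᵢ < P aⱼ`. -/
def Induces (P : FinPerm) (A : Finset (Fin P.order)) (p : FinPerm) : Prop :=
  ∃ h : A.card = p.order, ∀ i j : Fin p.order,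
    p.2 i < p.2 j ↔ P.2 (A.orderEmbOfFin h i) < P.2 (A.orderEmbOfFin h j)

open Classical in
/-- The pattern density of `p` in `P`: the proportion of those sets of positions of `P` of size
`p.order` that induce `p`. If `p.order > P.order`, there are no such sets and the value is `0`. -/
noncomputable def density (p P : FinPerm) : ℝ :=
  (((Finset.univ : Finset (Fin P.order)).powersetCard p.order).filter
      (fun A => P.Induces A p)).card / (P.order.choose p.order : ℝ)

/-- In the sequence `P`, the density of `p` converges to its expected value in a random
permutation. -/
def DensityTendsto (P : ℕ → FinPerm) (p : FinPerm) : Prop :=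
  Filter.Tendsto (fun i => density p (P i)) Filter.atTop (nhds (1 / (p.order.factorial : ℝ)))

/-- A sequence of permutations is quasirandom if the density of every permutation `p` in it
converges to `1 / |p|!`. -/
def Quasirandom (P : ℕ → FinPerm) : Prop :=
  ∀ p : FinPerm, DensityTendsto P p

/-- A set `S` of permutations is forcing if every sequence of permutations in which the density of
each `p ∈ S` converges to `1 / |p|!` is quasirandom. -/
def Forcing (S : Set FinPerm) : Prop :=
  ∀ P : ℕ → FinPerm, (∀ p ∈ S, DensityTendsto P p) → Quasirandom P

end FinPerm

/-!
# Every forcing set of permutations has at least four elements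

The density of a pattern `p` of order `k` in the permutation of a large random sample from a measure
`μ` on the plane is close to `k !` times the probability that `k` independent points, listed in a
given order, form `p`; the error has variance `O(1 / n)` (`exists_seq_density_tendsto`). So to see
that a set `S` of patterns is not forcing it is enough to find a density `1 + h ≥ 0` on the unit
square which gives all patterns in `S` the same probabilities as the uniform density, but gives a
further pattern `ρ` a different one (`not_forcing_of_density`). The inverse function theorem
provides such an `h` as soon as the derivatives at the uniform density (first variations) of the
probabilities of the patterns in `S ∪ {ρ}` are linearly independent (`exists_perturbation`).

The first variation of `p` in the direction `1[x ≤ s] - s` times `1[y ≤ u] - u` is computed from the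
distribution functions of order statistics, whose derivatives are Bernstein polynomials. A linear
relation between first variations therefore becomes a linear relation, up to constants, between the
polynomials `∑ m, B m (s) * B (p m) (u)`, where the `B m` are the Bernstein polynomials of degree
`k - 1` (`sum_mul_permKernel_eq`). Comparing degrees, a relation needs two patterns of the same
maximal order `k`. Three permutation matrices of size `k ≥ 4` satisfy no relation, even modulo
constants (`no_relation_same_order`), and two of them are not related to a shorter pattern
(`no_relation_shorter`). So a set of at most three patterns, one of which has order at least four,
is independent after removing patterns whose densities are determined by the others; a pattern `ρ`
longer than all of them keeps it independent (`eq_zero_of_sum_mul_permKernel_eq`).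

If all orders are at most three, there are genuine relations, and symmetry is used instead: for a
density with all symmetries of the square, the probabilities of all patterns of order at most three
are determined by that of `123`, and perturbing within such densities one can keep the probability
of `123` while changing that of `12345` (`not_forcing_of_order_le_three`).
-/

open MeasureTheory ProbabilityTheory Filter Topology

/-! ### Patterns in planar point sets -/

/-- The points `z 0, …, z (k - 1)` of the plane are listed from left to right and their heights are
ordered as the values of `p`. -/
def IsPattern {k : ℕ} (p : Equiv.Perm (Fin k)) (z : Fin k → ℝ × ℝ) : Prop :=
  StrictMono (fun i => (z i).1) ∧ StrictMono (fun i => (z (p.symm i)).2)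

theorem exists_rank {n : ℕ} (x : Fin n → ℝ) (hx : Function.Injective x) :
    ∃ e : Equiv.Perm (Fin n), StrictMono (x ∘ e) :=
  ⟨Tuple.sort x, (Tuple.monotone_sort x).strictMono_of_injective
    (hx.comp (Tuple.sort x).injective)⟩

theorem IsPattern.injective {k n : ℕ} {p : Equiv.Perm (Fin k)} {z : Fin n → ℝ × ℝ}
    {g : Fin k → Fin n} (h : IsPattern p (z ∘ g)) : Function.Injective g := by
  intro i j hij
  exact h.1.injective (by simp [hij])

open Classical in
/-- Every planar point set in general position is the plot of a permutation, whose pattern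
densities count the ways to list points of the set that form the pattern. -/
theorem exists_perm_density {n : ℕ} (z : Fin n → ℝ × ℝ)
    (hx : Function.Injective fun i => (z i).1) (hy : Function.Injective fun i => (z i).2) :
    ∃ P : Equiv.Perm (Fin n), ∀ p : FinPerm, FinPerm.density p ⟨n, P⟩ =
      ((Finset.univ : Finset (Fin p.1 → Fin n)).filter
        (fun g => IsPattern p.2 (z ∘ g))).card / (n.choose p.1 : ℝ) := by
  obtain ⟨e, he⟩ := exists_rank _ hx
  obtain ⟨f, hf⟩ := exists_rank _ hy
  refine ⟨e.trans f.symm, ?_⟩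
  rintro ⟨k, p⟩
  have hxe : ∀ i j, i < j ↔ (z (e i)).1 < (z (e j)).1 := fun i j => he.lt_iff_lt.symm
  have hyf : ∀ i j, f.symm i < f.symm j ↔ (z i).2 < (z j).2 := fun i j => by
    rw [← hf.lt_iff_lt]; simp
  unfold FinPerm.density
  congr 2
  symm
  have hmono : ∀ g : Fin k → Fin n, IsPattern p (z ∘ g) → StrictMono fun i => e.symm (g i) := by
    intro g hg i j hij
    rw [hxe]
    simpa using hg.1 hij
  have hcard : ∀ g : Fin k → Fin n, IsPattern p (z ∘ g) →
      (Finset.univ.image fun i => e.symm (g i)).card = k := by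
    intro g hg
    rw [Finset.card_image_of_injective _ (hmono g hg).injective, Finset.card_univ,
      Fintype.card_fin]
  have hemb : ∀ (g : Fin k → Fin n) (hg : IsPattern p (z ∘ g)), (fun i => e.symm (g i)) =
      (Finset.univ.image fun i => e.symm (g i)).orderEmbOfFin (hcard g hg) := by
    intro g hg
    exact Finset.orderEmbOfFin_unique (hcard g hg)
      (fun i => Finset.mem_image_of_mem _ (Finset.mem_univ i)) (hmono g hg)
  refine Finset.card_bij (fun g _ => Finset.univ.image fun i => e.symm (g i)) ?_ ?_ ?_
  · intro g hg
    simp only [Finset.mem_filter, Finset.mem_univ, true_and] at hg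
    simp only [Finset.mem_filter, Finset.mem_powersetCard, Finset.subset_univ, true_and]
    refine ⟨hcard g hg, hcard g hg, ?_⟩
    intro (i : Fin k) (j : Fin k)
    have h1 := congrFun (hemb g hg)
    change p i < p j ↔ f.symm (e _) < f.symm (e _)
    erw [← h1 i, ← h1 j]
    simp only [Equiv.apply_symm_apply]
    rw [hyf]
    have h2 := (hg.2.lt_iff_lt (a := p i) (b := p j)).symm
    simp only [Function.comp_apply, Equiv.symm_apply_apply p] at h2
    exact h2
  · intro g hg g' hg' h
    simp only [Finset.mem_filter, Finset.mem_univ, true_and] at hg hg'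
    have h1 := hemb g hg
    have h2 : (fun i => e.symm (g' i)) = (Finset.univ.image fun i => e.symm (g i)).orderEmbOfFin
        (hcard g hg) := by
      refine Finset.orderEmbOfFin_unique (hcard g hg) (fun i => ?_) (hmono g' hg')
      have h' : (Finset.univ.image fun i => e.symm (g i)) =
        Finset.univ.image fun i => e.symm (g' i) := h
      rw [h']
      exact Finset.mem_image_of_mem (fun i => e.symm (g' i)) (Finset.mem_univ i)
    funext i
    exact e.symm.injective (congrFun (h1.trans h2.symm) i)
  · intro (A : Finset (Fin n)) hA
    obtain ⟨-, (h : A.card = k), (hA : ∀ i j : Fin k, p i < p j ↔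
      f.symm (e (A.orderEmbOfFin h i)) < f.symm (e (A.orderEmbOfFin h j)))⟩ :=
      (Finset.mem_filter.1 hA)
    refine ⟨fun i => e (A.orderEmbOfFin h i), ?_, ?_⟩
    · simp only [Finset.mem_filter, Finset.mem_univ, true_and]
      refine ⟨fun i j hij => ?_, fun i j hij => ?_⟩
      · simpa using (hxe _ _).1 ((A.orderEmbOfFin h).strictMono hij)
      · have := (hA (p.symm i) (p.symm j)).1 (by simpa using hij)
        exact (hyf _ _).1 this
    · change (Finset.univ.image fun i : Fin k => e.symm (e (A.orderEmbOfFin h i))) = A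
      ext a
      simp only [Finset.mem_image, Finset.mem_univ, true_and, Equiv.symm_apply_apply]
      have := Finset.range_orderEmbOfFin A h
      rw [← Finset.mem_coe, ← this]
      rfl

/-! ### Densities in random samples -/

theorem measurableSet_isPattern {k : ℕ} (p : Equiv.Perm (Fin k)) :
    MeasurableSet {z : Fin k → ℝ × ℝ | IsPattern p z} := by
  have : {z : Fin k → ℝ × ℝ | IsPattern p z} =
      (⋂ i, ⋂ j, ⋂ (_ : i < j), {z : Fin k → ℝ × ℝ | (z i).1 < (z j).1}) ∩
      (⋂ i, ⋂ j, ⋂ (_ : i < j), {z : Fin k → ℝ × ℝ | (z (p.symm i)).2 < (z (p.symm j)).2}) := by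
    ext z
    simp [IsPattern, StrictMono]
  rw [this]
  refine MeasurableSet.inter ?_ ?_ <;>
  · refine MeasurableSet.iInter fun i => MeasurableSet.iInter fun j =>
      MeasurableSet.iInter fun _ => measurableSet_lt ?_ ?_ <;> fun_prop

/-- The probability that `k` independent points with law `μ`, listed in the given order, form the
pattern `p`. An unordered sample of `k` points forms `p` with probability `k !` times as large. -/
noncomputable def patternProb {k : ℕ} (p : Equiv.Perm (Fin k)) (μ : Measure (ℝ × ℝ)) : ℝ :=
  (Measure.pi fun _ : Fin k => μ).real {z | IsPattern p z}

/-- Selecting distinct coordinates of an i.i.d. sample yields an i.i.d. sample. -/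
theorem measurePreserving_comp_injective {ι κ α : Type*} [Fintype ι] [Fintype κ]
    [MeasurableSpace α] (μ : Measure α) [IsProbabilityMeasure μ] (g : κ → ι)
    (hg : Function.Injective g) :
    MeasurePreserving (fun z : ι → α => fun i => z (g i)) (Measure.pi fun _ => μ)
      (Measure.pi fun _ => μ) := by
  refine ⟨by fun_prop, ?_⟩
  have h1 := iIndepFun_pi (Ω := fun _ : ι => α) (μ := fun _ : ι => μ) (X := fun _ => id)
    (fun _ => aemeasurable_id)
  have h2 : iIndepFun (fun (i : κ) (ω : ι → α) => ω (g i)) (Measure.pi fun _ => μ) :=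
    iIndepFun.precomp hg h1
  have hm : ∀ i : κ, AEMeasurable (fun ω : ι → α => ω (g i)) (Measure.pi fun _ => μ) := fun i =>
    (measurable_pi_apply (g i)).aemeasurable
  rw [iIndepFun_iff_map_fun_eq_pi_map hm] at h2
  have h3 : ∀ i : κ, (Measure.pi fun _ : ι => μ).map (fun ω => ω (g i)) = μ := fun i =>
    (measurePreserving_eval (fun _ : ι => μ) (g i)).map_eq
  simp only [h3] at h2
  exact h2

/-- Two independent points almost surely differ under a map with atomless law. -/
theorem measure_pi_eq_null {α : Type*} [MeasurableSpace α] (μ : Measure α)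
    [IsProbabilityMeasure μ] {f : α → ℝ} (hf : Measurable f)
    (hμ : ∀ c, μ {z | f z = c} = 0) {ι : Type*} [Fintype ι] {i j : ι} (hij : i ≠ j) :
    (Measure.pi fun _ : ι => μ) {z | f (z i) = f (z j)} = 0 := by
  have hinj : Function.Injective ![i, j] := by
    intro a b
    fin_cases a <;> fin_cases b <;> simp [hij, hij.symm]
  have h := (measurePreserving_finTwoArrow μ).comp (measurePreserving_comp_injective μ ![i, j] hinj)
  have hm : MeasurableSet {q : α × α | f q.1 = f q.2} :=
    measurableSet_eq_fun (by fun_prop) (by fun_prop)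
  have h1 := h.measure_preimage hm.nullMeasurableSet
  have h2 : (μ.prod μ) {q : α × α | f q.1 = f q.2} = 0 := by
    rw [Measure.measure_prod_null hm]
    refine ae_of_all _ fun z => ?_
    have := hμ (f z)
    simpa [Set.preimage, eq_comm] using this
  rw [h2] at h1
  exact h1

theorem ae_injective {α : Type*} [MeasurableSpace α] (μ : Measure α) [IsProbabilityMeasure μ]
    {f : α → ℝ} (hf : Measurable f) (hμ : ∀ c, μ {z | f z = c} = 0)
    {ι : Type*} [Fintype ι] :
    ∀ᵐ z ∂(Measure.pi fun _ : ι => μ), Function.Injective fun i => f (z i) := by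
  have : ∀ i j : ι, i ≠ j → ∀ᵐ z ∂(Measure.pi fun _ : ι => μ), f (z i) ≠ f (z j) := by
    intro i j hij
    rw [ae_iff]
    simpa using measure_pi_eq_null μ hf hμ hij
  have h : ∀ᵐ z ∂(Measure.pi fun _ : ι => μ), ∀ i j : ι, i ≠ j → f (z i) ≠ f (z j) := by
    rw [ae_all_iff]; intro i
    rw [ae_all_iff]; intro j
    by_cases hij : i = j
    · exact ae_of_all _ fun z h => absurd hij h
    · filter_upwards [this i j hij] with z hz _ using hz
  filter_upwards [h] with z hz i j hij
  by_contra hne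
  exact hz i j hne hij

section
variable (μ : Measure (ℝ × ℝ)) [IsProbabilityMeasure μ] {n k : ℕ} (p : Equiv.Perm (Fin k))

theorem measureReal_isPattern_comp (g : Fin k → Fin n) (hg : Function.Injective g) :
    (Measure.pi fun _ : Fin n => μ).real {z | IsPattern p (z ∘ g)} = patternProb p μ := by
  have h := measurePreserving_comp_injective μ g hg
  exact h.measureReal_preimage (measurableSet_isPattern p).nullMeasurableSet

theorem measureReal_isPattern_comp_and (g g' : Fin k → Fin n) (hg : Function.Injective g)
    (hg' : Function.Injective g') (hd : ∀ i j, g i ≠ g' j) :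
    (Measure.pi fun _ : Fin n => μ).real {z | IsPattern p (z ∘ g) ∧ IsPattern p (z ∘ g')} =
      patternProb p μ ^ 2 := by
  have h := (measurePreserving_sumPiEquivProdPi (X := fun _ : Fin k ⊕ Fin k => ℝ × ℝ)
    (fun _ => μ)).comp (measurePreserving_comp_injective μ (Sum.elim g g')
    (hg.sumElim hg' hd))
  have h1 := h.measureReal_preimage
    ((measurableSet_isPattern p).prod (measurableSet_isPattern p)).nullMeasurableSet
  rw [measureReal_prod_prod] at h1
  rw [sq]
  exact h1

open Classical in
/-- The number of ways to list points of `z` that form the pattern `p`. -/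
noncomputable def patternCount (z : Fin n → ℝ × ℝ) : ℝ :=
  (((Finset.univ : Finset (Fin k → Fin n)).filter (fun g => IsPattern p (z ∘ g))).card : ℝ)

open Classical in
theorem patternCount_eq (z : Fin n → ℝ × ℝ) : patternCount p z =
    ∑ g : Fin k ↪ Fin n, {z | IsPattern p (z ∘ g)}.indicator (fun _ => (1 : ℝ)) z := by
  unfold patternCount
  simp only [Set.indicator_apply, Set.mem_ofPred_eq, Finset.sum_boole]
  norm_cast
  symm
  refine Finset.card_bij (fun g _ => g) ?_ ?_ ?_
  · intro g hg
    simpa using hg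
  · intro g _ g' _ h
    exact DFunLike.coe_injective h
  · intro g hg
    simp only [Finset.mem_filter, Finset.mem_univ, true_and] at hg
    exact ⟨⟨g, hg.injective⟩, by simpa using hg, rfl⟩

theorem measurableSet_isPattern_comp (g : Fin k → Fin n) :
    MeasurableSet {z : Fin n → ℝ × ℝ | IsPattern p (z ∘ g)} :=
  (by fun_prop : Measurable fun (z : Fin n → ℝ × ℝ) => z ∘ g) (measurableSet_isPattern p)

/-- The indicator of the event that the listed points form `p`, centred at its mean. -/
noncomputable def patternDev (g : Fin k ↪ Fin n) (z : Fin n → ℝ × ℝ) : ℝ :=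
  {z | IsPattern p (z ∘ g)}.indicator (fun _ => (1 : ℝ)) z - patternProb p μ

theorem patternProb_mem : patternProb p μ ∈ Set.Icc (0 : ℝ) 1 :=
  ⟨measureReal_nonneg, measureReal_le_one⟩

open Classical in
theorem abs_patternDev_le (g : Fin k ↪ Fin n) (z : Fin n → ℝ × ℝ) :
    |patternDev μ p g z| ≤ 1 := by
  have h := patternProb_mem μ p
  unfold patternDev
  rw [Set.indicator_apply, abs_le]
  split_ifs <;> constructor <;> linarith [h.1, h.2]

omit [IsProbabilityMeasure μ] in
theorem measurable_patternDev (g : Fin k ↪ Fin n) : Measurable (patternDev μ p g) :=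
  (measurable_const.indicator (measurableSet_isPattern_comp p g)).sub measurable_const

theorem integrable_patternDev_mul (g g' : Fin k ↪ Fin n) :
    Integrable (fun z => patternDev μ p g z * patternDev μ p g' z)
      (Measure.pi fun _ : Fin n => μ) := by
  refine Integrable.of_bound (C := 1)
    ((measurable_patternDev μ p g).mul (measurable_patternDev μ p g')).aestronglyMeasurable ?_
  refine ae_of_all _ fun z => ?_
  rw [Real.norm_eq_abs, abs_mul]
  exact mul_le_one₀ (abs_patternDev_le μ p g z) (abs_nonneg _) (abs_patternDev_le μ p g' z)

theorem integral_patternDev_mul_le (g g' : Fin k ↪ Fin n) :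
    ∫ z, patternDev μ p g z * patternDev μ p g' z ∂(Measure.pi fun _ : Fin n => μ) ≤ 1 := by
  have h := integral_mono (integrable_patternDev_mul μ p g g') (integrable_const (1 : ℝ))
    (fun z => (le_abs_self _).trans (by
      rw [abs_mul]
      exact mul_le_one₀ (abs_patternDev_le μ p g z) (abs_nonneg _) (abs_patternDev_le μ p g' z)))
  simpa using h

theorem integral_patternDev_mul_eq_zero (g g' : Fin k ↪ Fin n) (hd : ∀ i j, g i ≠ g' j) :
    ∫ z, patternDev μ p g z * patternDev μ p g' z ∂(Measure.pi fun _ : Fin n => μ) = 0 := by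
  set c := patternProb p μ with hc
  set A := {z : Fin n → ℝ × ℝ | IsPattern p (z ∘ g)} with hA
  set B := {z : Fin n → ℝ × ℝ | IsPattern p (z ∘ g')} with hB
  have hAm : MeasurableSet A := measurableSet_isPattern_comp p g
  have hBm : MeasurableSet B := measurableSet_isPattern_comp p g'
  have h1 : ∀ z, patternDev μ p g z * patternDev μ p g' z =
      (A ∩ B).indicator (fun _ => (1 : ℝ)) z - c * A.indicator (fun _ => (1 : ℝ)) z -
        c * B.indicator (fun _ => (1 : ℝ)) z + c ^ 2 := by
    intro z
    simp only [patternDev, ← hc, ← hA, ← hB]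
    have : (A ∩ B).indicator (fun _ => (1 : ℝ)) z =
        A.indicator (fun _ => (1 : ℝ)) z * B.indicator (fun _ => (1 : ℝ)) z := by
      rw [← Set.inter_indicator_mul]; simp
    rw [this]
    ring
  have hi : ∀ S : Set (Fin n → ℝ × ℝ), MeasurableSet S → Integrable
      (S.indicator fun _ => (1 : ℝ)) (Measure.pi fun _ : Fin n => μ) := fun S hS =>
    (integrable_const _).indicator hS
  have i1 : Integrable (fun z => c * A.indicator (fun _ => (1 : ℝ)) z)
    (Measure.pi fun _ : Fin n => μ) := (hi _ hAm).const_mul c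
  have i2 : Integrable (fun z => c * B.indicator (fun _ => (1 : ℝ)) z)
    (Measure.pi fun _ : Fin n => μ) := (hi _ hBm).const_mul c
  have i3 : Integrable (fun z => (A ∩ B).indicator (fun _ => (1 : ℝ)) z -
      c * A.indicator (fun _ => (1 : ℝ)) z) (Measure.pi fun _ : Fin n => μ) :=
    (hi _ (hAm.inter hBm)).sub i1
  have i4 : Integrable (fun z => (A ∩ B).indicator (fun _ => (1 : ℝ)) z -
      c * A.indicator (fun _ => (1 : ℝ)) z - c * B.indicator (fun _ => (1 : ℝ)) z)
      (Measure.pi fun _ : Fin n => μ) := i3.sub i2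
  simp only [h1]
  rw [integral_add i4 (integrable_const _), integral_sub i3 i2,
    integral_sub (hi _ (hAm.inter hBm)) i1,
    integral_const_mul, integral_const_mul, integral_indicator_const _ (hAm.inter hBm),
    integral_indicator_const _ hAm, integral_indicator_const _ hBm]
  have e1 := measureReal_isPattern_comp μ p g g.injective
  have e2 := measureReal_isPattern_comp μ p g' g'.injective
  have e3 := measureReal_isPattern_comp_and μ p g g' g.injective g'.injective hd
  have e4 : A ∩ B = {z | IsPattern p (z ∘ g) ∧ IsPattern p (z ∘ g')} := rfl
  rw [e4, e3, e1, e2]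
  simp
  ring

open Classical in
/-- Few pairs of `k`-tuples meet: at most a fraction `k ^ 2 / n` of them. -/
theorem card_meeting_mul_le :
    ((Finset.univ : Finset ((Fin k ↪ Fin n) × (Fin k ↪ Fin n))).filter
      (fun q => ∃ i j, q.1 i = q.2 j)).card * n ≤ k ^ 2 * n ^ (2 * k) := by
  have hcount : ∀ (j : Fin k) (a : Fin n),
      ((Finset.univ : Finset (Fin k → Fin n)).filter (fun g => g j = a)).card * n = n ^ k := by
    intro j a
    have h := Fintype.card_filter_piFinset_const (Finset.univ : Finset (Fin n)) j a
    simp at h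
    rw [h, ← pow_succ]
    congr 1
    have := j.pos
    omega
  have hsub : ((Finset.univ : Finset ((Fin k ↪ Fin n) × (Fin k ↪ Fin n))).filter
      (fun q => ∃ i j, q.1 i = q.2 j)).card ≤
      ∑ i : Fin k, ∑ j : Fin k, ∑ g : Fin k → Fin n,
        ((Finset.univ : Finset (Fin k → Fin n)).filter (fun g' => g' j = g i)).card := by
    calc _ ≤ ((Finset.univ : Finset (Fin k × Fin k)).biUnion fun ij =>
          (Finset.univ : Finset ((Fin k → Fin n) × (Fin k → Fin n))).filter
            (fun q => q.2 ij.2 = q.1 ij.1)).card := by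
          refine Finset.card_le_card_of_injOn (fun q => (⇑q.1, ⇑q.2)) ?_ ?_
          · rintro ⟨g, g'⟩ h
            simp only [Finset.coe_filter, Finset.mem_univ, true_and, Set.mem_ofPred_eq] at h
            obtain ⟨i, j, h⟩ := h
            simp only [Finset.coe_biUnion, Set.mem_iUnion, Finset.coe_filter, Finset.mem_univ,
              true_and, Set.mem_ofPred_eq, Finset.coe_univ, Set.mem_univ]
            exact ⟨(i, j), trivial, h.symm⟩
          · rintro ⟨g, g'⟩ _ ⟨f, f'⟩ _ h
            simp only [Prod.mk.injEq, DFunLike.coe_fn_eq] at h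
            exact Prod.ext h.1 h.2
      _ ≤ ∑ ij : Fin k × Fin k, ((Finset.univ : Finset ((Fin k → Fin n) × (Fin k → Fin n))).filter
            (fun q => q.2 ij.2 = q.1 ij.1)).card := Finset.card_biUnion_le
      _ = _ := by
          rw [Fintype.sum_prod_type]
          refine Finset.sum_congr rfl fun i _ => Finset.sum_congr rfl fun j _ => ?_
          simp only [Finset.card_filter]
          rw [Fintype.sum_prod_type]
  refine (Nat.mul_le_mul_right n hsub).trans ?_
  simp only [Finset.sum_mul, hcount]
  simp
  apply le_of_eq
  ring

omit [IsProbabilityMeasure μ] in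
theorem patternCount_sub (z : Fin n → ℝ × ℝ) :
    patternCount p z - n.descFactorial k * patternProb p μ =
      ∑ g : Fin k ↪ Fin n, patternDev μ p g z := by
  simp only [patternDev, Finset.sum_sub_distrib, patternCount_eq]
  simp [Fintype.card_embedding_eq]

theorem integrable_patternCount_sub_sq :
    Integrable (fun z => (patternCount p z - n.descFactorial k * patternProb p μ) ^ 2)
      (Measure.pi fun _ : Fin n => μ) := by
  simp only [patternCount_sub, sq, Finset.sum_mul_sum]
  exact integrable_finsetSum _ fun g _ => integrable_finsetSum _ fun g' _ =>
    integrable_patternDev_mul μ p g g'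

theorem integral_patternCount_sub_sq_mul_le :
    (∫ z, (patternCount p z - n.descFactorial k * patternProb p μ) ^ 2
      ∂(Measure.pi fun _ : Fin n => μ)) * n ≤ (k : ℝ) ^ 2 * (n : ℝ) ^ (2 * k) := by
  classical
  have h1 : (∫ z, (patternCount p z - n.descFactorial k * patternProb p μ) ^ 2
      ∂(Measure.pi fun _ : Fin n => μ)) ≤
      ((Finset.univ : Finset ((Fin k ↪ Fin n) × (Fin k ↪ Fin n))).filter
        (fun q => ∃ i j, q.1 i = q.2 j)).card := by
    simp only [patternCount_sub, sq, Finset.sum_mul_sum]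
    rw [integral_finsetSum _ fun g _ => integrable_finsetSum _ fun g' _ =>
      integrable_patternDev_mul μ p g g']
    simp only [integral_finsetSum _ fun g' _ => integrable_patternDev_mul μ p _ g']
    rw [Finset.card_filter]
    push_cast
    rw [Fintype.sum_prod_type]
    refine Finset.sum_le_sum fun g _ => Finset.sum_le_sum fun g' _ => ?_
    split_ifs with h
    · exact integral_patternDev_mul_le μ p g g'
    · push Not at h
      exact (integral_patternDev_mul_eq_zero μ p g g' h).le
  refine (mul_le_mul_of_nonneg_right h1 (Nat.cast_nonneg n)).trans ?_
  exact_mod_cast card_meeting_mul_le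

/-- The variance of a pattern density in a sample of size `n` is `O(1 / n)`. -/
theorem integral_density_sub_sq_le (hn : 2 * k ≤ n) (hn0 : 0 < n) :
    (∫ z, (patternCount p z / n.choose k - k.factorial * patternProb p μ) ^ 2
      ∂(Measure.pi fun _ : Fin n => μ)) ≤ ((k : ℝ) * (2 ^ k * k.factorial)) ^ 2 / n := by
  have hC : (0 : ℝ) < n.choose k := by exact_mod_cast Nat.choose_pos (by omega)
  have hn' : (0 : ℝ) < n := by exact_mod_cast hn0
  have hdesc : (n.descFactorial k : ℝ) = k.factorial * n.choose k := by
    exact_mod_cast Nat.descFactorial_eq_factorial_mul_choose n k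
  have h1 : ∀ z : Fin n → ℝ × ℝ,
      (patternCount p z / n.choose k - k.factorial * patternProb p μ) ^ 2 =
      (patternCount p z - n.descFactorial k * patternProb p μ) ^ 2 * ((n.choose k : ℝ) ^ 2)⁻¹ := by
    intro z
    rw [hdesc]
    field_simp
  simp only [h1]
  rw [integral_mul_const, le_div_iff₀ hn', mul_right_comm]
  have h2 := integral_patternCount_sub_sq_mul_le (n := n) μ p
  have h3 : (n : ℝ) ^ k ≤ 2 ^ k * k.factorial * n.choose k := by
    have : n ^ k ≤ 2 ^ k * n.descFactorial k := by
      refine le_trans ?_ (Nat.mul_le_mul_left _ (Nat.pow_sub_le_descFactorial n k))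
      rw [← mul_pow]
      exact Nat.pow_le_pow_left (by omega) k
    rw [mul_assoc, ← hdesc]
    exact_mod_cast this
  rw [← div_eq_mul_inv, div_le_iff₀ (by positivity)]
  refine h2.trans ?_
  calc (k : ℝ) ^ 2 * (n : ℝ) ^ (2 * k) = (k : ℝ) ^ 2 * ((n : ℝ) ^ k) ^ 2 := by ring
    _ ≤ (k : ℝ) ^ 2 * (2 ^ k * k.factorial * n.choose k) ^ 2 := by gcongr
    _ = _ := by ring

theorem exists_perm_density_close (hx : ∀ c, μ {z | z.1 = c} = 0) (hy : ∀ c, μ {z | z.2 = c} = 0)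
    (T : Finset FinPerm) (hn : ∀ p ∈ T, 2 * p.1 ≤ n) (hn0 : 0 < n) :
    ∃ P : Equiv.Perm (Fin n), ∑ p ∈ T, (FinPerm.density p ⟨n, P⟩ -
      p.1.factorial * patternProb p.2 μ) ^ 2 ≤
        (∑ p ∈ T, ((p.1 : ℝ) * (2 ^ p.1 * p.1.factorial)) ^ 2) / n := by
  have hint : ∀ p ∈ T, Integrable (fun z => (patternCount p.2 z / n.choose p.1 -
      p.1.factorial * patternProb p.2 μ) ^ 2) (Measure.pi fun _ : Fin n => μ) := by
    intro p hp
    have hC : (0 : ℝ) < n.choose p.1 := by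
      exact_mod_cast Nat.choose_pos (by have := hn p hp; omega)
    have hdesc : (n.descFactorial p.1 : ℝ) = p.1.factorial * n.choose p.1 := by
      exact_mod_cast Nat.descFactorial_eq_factorial_mul_choose n p.1
    convert (integrable_patternCount_sub_sq (n := n) μ p.2).mul_const
      (((n.choose p.1 : ℝ) ^ 2)⁻¹) using 2 with z
    rw [hdesc]
    field_simp
  have hae := (ae_injective μ measurable_fst hx (ι := Fin n)).and
    (ae_injective μ measurable_snd hy (ι := Fin n))
  obtain ⟨z, hz, hle⟩ := exists_notMem_null_le_integral (integrable_finsetSum T hint) hae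
  simp only [Set.mem_compl_iff, not_not] at hz
  obtain ⟨P, hP⟩ := exists_perm_density z hz.1 hz.2
  refine ⟨P, ?_⟩
  simp only [hP]
  refine hle.trans ?_
  rw [integral_finsetSum T hint, Finset.sum_div]
  exact Finset.sum_le_sum fun p hp => integral_density_sub_sq_le μ p.2 (hn p hp) hn0

/-- The permutations of large random samples of `μ` have the pattern densities of `μ`. -/
theorem exists_seq_density_tendsto (hx : ∀ c, μ {z | z.1 = c} = 0)
    (hy : ∀ c, μ {z | z.2 = c} = 0) (T : Finset FinPerm) :
    ∃ P : ∀ n : ℕ, Equiv.Perm (Fin n), ∀ p ∈ T, Tendsto (fun n => FinPerm.density p ⟨n, P n⟩) atTop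
      (𝓝 (p.1.factorial * patternProb p.2 μ)) := by
  set M := 2 * ∑ p ∈ T, p.1 + 1 with hM
  have hMn : ∀ n, M ≤ n → ∀ p ∈ T, 2 * p.1 ≤ n := by
    intro n hn p hp
    have := Finset.single_le_sum (f := fun p : FinPerm => p.1) (fun _ _ => Nat.zero_le _) hp
    omega
  have hex : ∀ n, ∃ P : Equiv.Perm (Fin n), M ≤ n → ∑ p ∈ T, (FinPerm.density p ⟨n, P⟩ -
      p.1.factorial * patternProb p.2 μ) ^ 2 ≤
        (∑ p ∈ T, ((p.1 : ℝ) * (2 ^ p.1 * p.1.factorial)) ^ 2) / n := by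
    intro n
    by_cases hn : M ≤ n
    · obtain ⟨P, hP⟩ := exists_perm_density_close μ hx hy T (hMn n hn) (by omega)
      exact ⟨P, fun _ => hP⟩
    -- The finitely many small `n` do not affect the limit.
    · exact ⟨1, fun h => absurd h hn⟩
  choose P hP using hex
  refine ⟨P, fun p hp => ?_⟩
  have h0 : Tendsto (fun n : ℕ => (∑ p ∈ T, ((p.1 : ℝ) * (2 ^ p.1 * p.1.factorial)) ^ 2) / (n : ℝ))
    atTop (𝓝 0) := tendsto_const_div_atTop_nhds_zero_nat _
  have h1 : Tendsto (fun n => (FinPerm.density p ⟨n, P n⟩ -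
      p.1.factorial * patternProb p.2 μ) ^ 2) atTop (𝓝 0) := by
    refine squeeze_zero' (Eventually.of_forall fun n => sq_nonneg _) ?_ h0
    filter_upwards [eventually_ge_atTop M] with n hn
    exact (Finset.single_le_sum (f := fun p : FinPerm => (FinPerm.density p ⟨n, P n⟩ -
      p.1.factorial * patternProb p.2 μ) ^ 2) (fun _ _ => sq_nonneg _) hp).trans (hP n hn)
  have h2 : Tendsto (fun n => FinPerm.density p ⟨n, P n⟩ -
      p.1.factorial * patternProb p.2 μ) atTop (𝓝 0) := by
    rw [tendsto_zero_iff_abs_tendsto_zero]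
    have := (Real.continuous_sqrt.tendsto 0).comp h1
    simpa [Function.comp_def, Real.sqrt_sq_eq_abs] using this
  simpa using h2.add_const (p.1.factorial * patternProb p.2 μ)

end

/-! ### Perturbations of the uniform density -/

/-- The uniform measure on `[0, 1]`. -/
noncomputable def unitMeasure : Measure ℝ := volume.restrict (Set.Icc 0 1)

instance : IsProbabilityMeasure unitMeasure := ⟨by simp [unitMeasure]⟩

theorem unitMeasure_singleton (c : ℝ) : unitMeasure {c} = 0 := by
  unfold unitMeasure
  exact le_antisymm ((Measure.restrict_apply_le _ _).trans (by simp)) zero_le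

/-- The uniform measure on the unit square. -/
noncomputable def squareMeasure : Measure (ℝ × ℝ) := unitMeasure.prod unitMeasure

instance : IsProbabilityMeasure squareMeasure := by unfold squareMeasure; infer_instance

theorem squareMeasure_fst_eq (c : ℝ) : squareMeasure {z | z.1 = c} = 0 := by
  have : {z : ℝ × ℝ | z.1 = c} = {c} ×ˢ Set.univ := by ext; simp
  rw [this, squareMeasure, Measure.prod_prod, unitMeasure_singleton, zero_mul]

theorem squareMeasure_snd_eq (c : ℝ) : squareMeasure {z | z.2 = c} = 0 := by
  have : {z : ℝ × ℝ | z.2 = c} = Set.univ ×ˢ {c} := by ext; simp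
  rw [this, squareMeasure, Measure.prod_prod, unitMeasure_singleton, mul_zero]

/-- The measure on the unit square with density `f`. -/
noncomputable def densityMeasure (f : ℝ × ℝ → ℝ) : Measure (ℝ × ℝ) :=
  squareMeasure.withDensity fun z => ENNReal.ofReal (f z)

/-- The integral over all `z` that form the pattern `p` of the product of the values of `f`. If `f`
is a probability density, this is the probability `patternProb p (densityMeasure f)`; as a
polynomial expression in `f` it also makes sense when `f` takes negative values. -/
noncomputable def patternIntegral {k : ℕ} (p : Equiv.Perm (Fin k)) (f : ℝ × ℝ → ℝ) : ℝ :=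
  ∫ z in {z | IsPattern p z}, ∏ i, f (z i) ∂(Measure.pi fun _ : Fin k => squareMeasure)

/-- The derivative of `patternIntegral p` at the constant density `1` in the direction `h`. -/
noncomputable def firstVariation {k : ℕ} (p : Equiv.Perm (Fin k)) (h : ℝ × ℝ → ℝ) : ℝ :=
  ∑ m, ∫ z in {z | IsPattern p z}, h (z m) ∂(Measure.pi fun _ : Fin k => squareMeasure)

/-- The bounded measurable functions on the square with vanishing integral: the directions in which
the uniform density can be perturbed. -/
def balanced : Submodule ℝ (ℝ × ℝ → ℝ) where
  carrier := {h | Measurable h ∧ (∃ C, ∀ z, |h z| ≤ C) ∧ ∫ z, h z ∂squareMeasure = 0}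
  zero_mem' := ⟨measurable_const, ⟨0, by simp⟩, by simp⟩
  add_mem' := by
    rintro a b ⟨ha, ⟨C, hC⟩, hai⟩ ⟨hb, ⟨D, hD⟩, hbi⟩
    refine ⟨ha.add hb, ⟨C + D, fun z => (abs_add_le _ _).trans (add_le_add (hC z) (hD z))⟩, ?_⟩
    have i1 : Integrable a squareMeasure :=
      Integrable.of_bound ha.aestronglyMeasurable C (ae_of_all _ hC)
    have i2 : Integrable b squareMeasure :=
      Integrable.of_bound hb.aestronglyMeasurable D (ae_of_all _ hD)
    simp only [Pi.add_apply]
    rw [integral_add i1 i2, hai, hbi, add_zero]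
  smul_mem' := by
    rintro c a ⟨ha, ⟨C, hC⟩, hai⟩
    refine ⟨ha.const_smul c, ⟨|c| * C, fun z => ?_⟩, ?_⟩
    · simp only [Pi.smul_apply, smul_eq_mul, abs_mul]
      exact mul_le_mul_of_nonneg_left (hC z) (abs_nonneg c)
    · simp only [Pi.smul_apply, smul_eq_mul]
      rw [integral_const_mul, hai, mul_zero]

theorem integrable_prod {k : ℕ} {F : Fin k → ℝ × ℝ → ℝ} (hF : ∀ i, Measurable (F i))
    (hb : ∀ i, ∃ C, ∀ z, |F i z| ≤ C) (ν : Measure (Fin k → ℝ × ℝ)) [IsFiniteMeasure ν] :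
    Integrable (fun z => ∏ i, F i (z i)) ν := by
  choose C hC using hb
  have hm : Measurable fun z : Fin k → ℝ × ℝ => ∏ i, F i (z i) :=
    Finset.measurable_fun_prod _ fun i _ => (hF i).comp (measurable_pi_apply i)
  refine Integrable.of_bound (C := ∏ i, C i) hm.aestronglyMeasurable (ae_of_all _ fun z => ?_)
  rw [Real.norm_eq_abs, Finset.abs_prod]
  exact Finset.prod_le_prod (fun i _ => abs_nonneg _) fun i _ => hC i (z i)

theorem pi_densityMeasure {f : ℝ × ℝ → ℝ} (hf : Measurable f) (hb : ∃ C, ∀ z, |f z| ≤ C)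
    (h0 : ∀ z, 0 ≤ f z) [IsProbabilityMeasure (densityMeasure f)] (k : ℕ) :
    (Measure.pi fun _ : Fin k => densityMeasure f) =
      (Measure.pi fun _ : Fin k => squareMeasure).withDensity
        fun z => ENNReal.ofReal (∏ i, f (z i)) := by
  refine Measure.pi_eq fun s hs => ?_
  rw [withDensity_apply _ (MeasurableSet.univ_pi hs), Measure.restrict_pi_pi,
    ← ofReal_integral_eq_lintegral_ofReal]
  · rw [integral_fintype_prod_eq_prod (fun _ => f), ENNReal.ofReal_prod_of_nonneg]
    · refine Finset.prod_congr rfl fun i _ => ?_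
      obtain ⟨C, hC⟩ := hb
      rw [densityMeasure, withDensity_apply _ (hs i), ofReal_integral_eq_lintegral_ofReal]
      · exact Integrable.of_bound hf.aestronglyMeasurable C (ae_of_all _ hC)
      · exact ae_of_all _ h0
    · exact fun i _ => integral_nonneg h0
  · exact integrable_prod (fun _ => hf) (fun _ => hb) _
  · exact ae_of_all _ fun z => Finset.prod_nonneg fun i _ => h0 _

theorem isProbabilityMeasure_densityMeasure {h : ℝ × ℝ → ℝ} (hh : h ∈ balanced)
    (h0 : ∀ z, 0 ≤ 1 + h z) : IsProbabilityMeasure (densityMeasure fun z => 1 + h z) := by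
  obtain ⟨hm, ⟨C, hC⟩, hi⟩ := hh
  have hint : Integrable h squareMeasure :=
    Integrable.of_bound hm.aestronglyMeasurable C (ae_of_all _ hC)
  have hint' : Integrable (fun z => 1 + h z) squareMeasure := (integrable_const _).add hint
  refine ⟨?_⟩
  rw [densityMeasure, withDensity_apply _ MeasurableSet.univ, Measure.restrict_univ,
    ← ofReal_integral_eq_lintegral_ofReal hint' (ae_of_all _ h0)]
  rw [integral_add (integrable_const _) hint, hi]
  simp

theorem exists_bound_one_add {h : ℝ × ℝ → ℝ} (hh : h ∈ balanced) :
    ∃ C, ∀ z, |1 + h z| ≤ C := by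
  obtain ⟨-, ⟨C, hC⟩, -⟩ := hh
  exact ⟨1 + C, fun z => (abs_add_le _ _).trans (by simpa using hC z)⟩

theorem patternProb_densityMeasure {h : ℝ × ℝ → ℝ} (hh : h ∈ balanced)
    (h0 : ∀ z, 0 ≤ 1 + h z) {k : ℕ} (p : Equiv.Perm (Fin k)) :
    patternProb p (densityMeasure fun z => 1 + h z) = patternIntegral p fun z => 1 + h z := by
  have := isProbabilityMeasure_densityMeasure hh h0
  have hb := exists_bound_one_add hh
  have hm : Measurable fun z => 1 + h z := measurable_const.add hh.1
  rw [patternProb, patternIntegral, pi_densityMeasure hm hb h0, measureReal_def,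
    withDensity_apply _ (measurableSet_isPattern p),
    ← ofReal_integral_eq_lintegral_ofReal (integrable_prod (fun _ => hm) (fun _ => hb) _)
      (ae_of_all _ fun z => Finset.prod_nonneg fun i _ => h0 _), ENNReal.toReal_ofReal]
  exact integral_nonneg fun z => Finset.prod_nonneg fun i _ => h0 _

/-- A nonnegative density that gives every pattern in `S` its expected probability, but not the
pattern `ρ`, yields a sequence of permutations showing that `S` is not forcing. -/
theorem not_forcing_of_density {h : ℝ × ℝ → ℝ} (hh : h ∈ balanced) (h0 : ∀ z, 0 ≤ 1 + h z)
    (S : Finset FinPerm)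
    (hS : ∀ p ∈ S, patternIntegral p.2 (fun z => 1 + h z) = (1 / (p.1.factorial : ℝ)) ^ 2)
    (ρ : FinPerm)
    (hρ : patternIntegral ρ.2 (fun z => 1 + h z) ≠ (1 / (ρ.1.factorial : ℝ)) ^ 2) :
    ¬ FinPerm.Forcing (S : Set FinPerm) := by
  classical
  intro hforce
  have := isProbabilityMeasure_densityMeasure hh h0
  have hac : densityMeasure (fun z => 1 + h z) ≪ squareMeasure :=
    withDensity_absolutelyContinuous _ _
  obtain ⟨P, hP⟩ := exists_seq_density_tendsto (densityMeasure fun z => 1 + h z)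
    (fun c => hac (squareMeasure_fst_eq c)) (fun c => hac (squareMeasure_snd_eq c)) (insert ρ S)
  simp only [patternProb_densityMeasure hh h0] at hP
  have h1 : ∀ p ∈ (S : Set FinPerm), FinPerm.DensityTendsto (fun n => ⟨n, P n⟩) p := by
    intro p hp
    have h2 := hP p (Finset.mem_insert_of_mem hp)
    rw [hS p hp] at h2
    have h3 : (0 : ℝ) < p.1.factorial := by exact_mod_cast p.1.factorial_pos
    have h4 : (p.1.factorial : ℝ) * (1 / p.1.factorial) ^ 2 = 1 / p.1.factorial := by field_simp
    rw [h4] at h2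
    exact h2
  have h2 := tendsto_nhds_unique (hforce _ h1 ρ) (hP ρ (Finset.mem_insert_self _ _))
  change 1 / (ρ.1.factorial : ℝ) = _ at h2
  have h3 : (0 : ℝ) < ρ.1.factorial := by exact_mod_cast ρ.1.factorial_pos
  apply hρ
  field_simp at h2 ⊢
  linarith

/-- The coefficients of the constant `1` and of the directions of perturbation in the density
`1 + ∑ j, t j * h j`. -/
def optionCoeff {J : Type*} (t : J → ℝ) : Option J → ℝ
  | none => 1
  | some j => t j

/-- The constant `1` and the directions of perturbation. -/
def optionFun {J : Type*} (h : J → ℝ × ℝ → ℝ) : Option J → ℝ × ℝ → ℝ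
  | none => fun _ => 1
  | some j => h j

section
variable {J : Type*} [Fintype J] {h : J → ℝ × ℝ → ℝ} (hh : ∀ j, h j ∈ balanced)
include hh

omit [Fintype J] in
theorem measurable_optionFun (o : Option J) : Measurable (optionFun h o) := by
  cases o with
  | none => exact measurable_const
  | some j => exact (hh j).1

omit [Fintype J] in
theorem exists_bound_optionFun (o : Option J) : ∃ C, ∀ z, |optionFun h o z| ≤ C := by
  cases o with
  | none => exact ⟨1, by simp [optionFun]⟩
  | some j => exact (hh j).2.1

theorem patternIntegral_expand {k : ℕ} (p : Equiv.Perm (Fin k)) (c : Fin k → Option J → ℝ) :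
    ∫ z in {z | IsPattern p z}, ∏ i, ∑ o, c i o * optionFun h o (z i)
      ∂(Measure.pi fun _ : Fin k => squareMeasure) =
    ∑ φ : Fin k → Option J, (∏ i, c i (φ i)) * ∫ z in {z | IsPattern p z},
      ∏ i, optionFun h (φ i) (z i) ∂(Measure.pi fun _ : Fin k => squareMeasure) := by
  classical
  simp only [Finset.prod_univ_sum, Fintype.piFinset_univ, Finset.prod_mul_distrib]
  rw [integral_finsetSum]
  · simp only [integral_const_mul]
  · exact fun φ _ => (integrable_prod (fun i => measurable_optionFun hh (φ i))
      (fun i => exists_bound_optionFun hh (φ i)) _).const_mul _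

theorem hasStrictFDerivAt_patternIntegral {k : ℕ} (p : Equiv.Perm (Fin k)) :
    HasStrictFDerivAt (fun t : J → ℝ => patternIntegral p fun z => 1 + ∑ j, t j * h j z)
      (∑ j, (firstVariation p (h j)) • ContinuousLinearMap.proj (R := ℝ) (φ := fun _ : J => ℝ) j)
      0 := by
  classical
  have hfun : (fun t : J → ℝ => patternIntegral p fun z => 1 + ∑ j, t j * h j z) = fun t =>
      ∑ φ : Fin k → Option J, (∏ i, optionCoeff t (φ i)) * ∫ z in {z | IsPattern p z},
        ∏ i, optionFun h (φ i) (z i) ∂(Measure.pi fun _ : Fin k => squareMeasure) := by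
    funext t
    rw [← patternIntegral_expand hh p fun _ => optionCoeff t]
    simp [patternIntegral, Fintype.sum_option, optionCoeff, optionFun]
  let D : Option J → (J → ℝ) →L[ℝ] ℝ := fun o => match o with
    | none => 0
    | some j => ContinuousLinearMap.proj j
  have hD : ∀ o : Option J, HasStrictFDerivAt (fun t : J → ℝ => optionCoeff t o) (D o) 0 := by
    intro o
    cases o with
    | none => exact hasStrictFDerivAt_const _ _
    | some j => exact (ContinuousLinearMap.proj (R := ℝ) (φ := fun _ : J => ℝ) j).hasStrictFDerivAt
  rw [hfun]
  have h1 := HasStrictFDerivAt.fun_sum (u := (Finset.univ : Finset (Fin k → Option J)))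
    fun φ _ => (HasStrictFDerivAt.finsetProd (u := (Finset.univ : Finset (Fin k)))
      fun i _ => hD (φ i)).mul_const (∫ z in {z | IsPattern p z},
        ∏ i, optionFun h (φ i) (z i) ∂(Measure.pi fun _ : Fin k => squareMeasure))
  refine h1.congr_fderiv (ContinuousLinearMap.ext fun v => ?_)
  have h2 : ∀ m : Fin k, ∑ j, v j * ∫ z in {z | IsPattern p z}, h j (z m)
        ∂(Measure.pi fun _ : Fin k => squareMeasure) =
      ∑ φ : Fin k → Option J,
        (∏ i, if i = m then D (φ i) v else optionCoeff (0 : J → ℝ) (φ i)) *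
        ∫ z in {z | IsPattern p z}, ∏ i, optionFun h (φ i) (z i)
          ∂(Measure.pi fun _ : Fin k => squareMeasure) := by
    intro m
    rw [← patternIntegral_expand hh p fun i o =>
      if i = m then D o v else optionCoeff (0 : J → ℝ) o]
    have h3 : ∀ z : Fin k → ℝ × ℝ, ∏ i, ∑ o, (if i = m then D o v else
        optionCoeff (0 : J → ℝ) o) * optionFun h o (z i) = ∑ j, v j * h j (z m) := by
      intro z
      rw [Finset.prod_eq_single m]
      · simp [Fintype.sum_option, D, optionFun]
      · intro i _ hi
        simp [hi, Fintype.sum_option, optionFun, optionCoeff]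
      · simp
    simp only [h3]
    rw [integral_finsetSum]
    · simp only [integral_const_mul]
    · intro j _
      obtain ⟨C, hC⟩ := (hh j).2.1
      have hm : Measurable fun z : Fin k → ℝ × ℝ => h j (z m) :=
        (hh j).1.comp (measurable_pi_apply m)
      exact (Integrable.of_bound hm.aestronglyMeasurable C
        (ae_of_all _ fun z => hC (z m))).const_mul _
  have h4 : ∀ (m : Fin k) (φ : Fin k → Option J),
      (∏ i, if i = m then D (φ i) v else optionCoeff (0 : J → ℝ) (φ i)) =
      (∏ i ∈ Finset.univ.erase m, optionCoeff (0 : J → ℝ) (φ i)) * D (φ m) v := by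
    intro m φ
    rw [← Finset.prod_erase_mul _ _ (Finset.mem_univ m)]
    simp only [if_true]
    congr 1
    refine Finset.prod_congr rfl fun i hi => ?_
    rw [if_neg (Finset.ne_of_mem_erase hi)]
  have h5 : (∑ j, (firstVariation p (h j)) •
      ContinuousLinearMap.proj (R := ℝ) (φ := fun _ : J => ℝ) j) v =
      ∑ m : Fin k, ∑ j, v j * ∫ z in {z | IsPattern p z}, h j (z m)
        ∂(Measure.pi fun _ : Fin k => squareMeasure) := by
    rw [Finset.sum_comm]
    simp [firstVariation, Finset.mul_sum, mul_comm]
  rw [h5]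
  simp only [h2, h4]
  rw [Finset.sum_comm]
  simp only [← Finset.sum_mul]
  simp [mul_comm]

end

/-- If the first variations of the patterns `p i` take arbitrary joint values on `W`, then by
the inverse function theorem the probabilities of these patterns can be moved in any prescribed
direction `w` by perturbing the uniform density within `W`. -/
theorem exists_perturbation {ι : Type*} [Fintype ι] (W : Submodule ℝ (ℝ × ℝ → ℝ))
    (hW : W ≤ balanced) (p : ι → FinPerm)
    (hsurj : ∀ w : ι → ℝ, ∃ h ∈ W, ∀ i, firstVariation (p i).2 h = w i) (w : ι → ℝ) :
    ∃ h ∈ W, (∀ z, 0 ≤ 1 + h z) ∧ ∃ η : ℝ, η ≠ 0 ∧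
      ∀ i, patternIntegral (p i).2 (fun z => 1 + h z) =
        patternIntegral (p i).2 (fun _ => 1) + η * w i := by
  classical
  choose h hhW hh using fun i : ι => hsurj (Pi.single i 1)
  have hhb : ∀ i, h i ∈ balanced := fun i => hW (hhW i)
  choose C hC using fun i => (hhb i).2.1
  let I : (ι → ℝ) → (ι → ℝ) := fun t i => patternIntegral (p i).2 fun z => 1 + ∑ j, t j * h j z
  have hI : HasStrictFDerivAt I (ContinuousLinearMap.id ℝ (ι → ℝ)) 0 := by
    rw [hasStrictFDerivAt_pi']
    intro i
    refine (hasStrictFDerivAt_patternIntegral hhb (p i).2).congr_fderiv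
      (ContinuousLinearMap.ext fun v => ?_)
    simp [hh, Pi.single_apply]
  have hmap := hI.map_nhds_eq_of_surj (by simp)
  have hI0 : I 0 = fun i => patternIntegral (p i).2 fun _ => 1 := by
    funext i
    simp [I]
  have hpos : ∀ᶠ t in 𝓝 (0 : ι → ℝ), ∀ z, 0 ≤ 1 + ∑ j, t j * h j z := by
    have h1 : Tendsto (fun t : ι → ℝ => ∑ j, |t j| * C j) (𝓝 0) (𝓝 0) := by
      have : Continuous fun t : ι → ℝ => ∑ j, |t j| * C j := by fun_prop
      simpa using this.tendsto 0
    filter_upwards [h1.eventually (gt_mem_nhds one_pos)] with t ht z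
    have h2 : |∑ j, t j * h j z| ≤ ∑ j, |t j| * C j := by
      refine (Finset.abs_sum_le_sum_abs _ _).trans (Finset.sum_le_sum fun j _ => ?_)
      rw [abs_mul]
      exact mul_le_mul_of_nonneg_left (hC j z) (abs_nonneg _)
    linarith [neg_abs_le (∑ j, t j * h j z)]
  have himg : I '' {t | ∀ z, 0 ≤ 1 + ∑ j, t j * h j z} ∈ 𝓝 (I 0) := by
    rw [← hmap]
    exact image_mem_map hpos
  have hline : Tendsto (fun η : ℝ => I 0 + η • w) (𝓝[≠] 0) (𝓝 (I 0)) := by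
    have : Continuous fun η : ℝ => I 0 + η • w := by fun_prop
    simpa using (this.tendsto 0).mono_left nhdsWithin_le_nhds
  obtain ⟨η, ⟨t, ht, hteq⟩, hη⟩ := ((hline.eventually himg).and self_mem_nhdsWithin).exists
  refine ⟨fun z => ∑ j, t j * h j z, ?_, ht, η, hη, fun i => ?_⟩
  · have : (fun z => ∑ j, t j * h j z) = ∑ j, t j • h j := by
      funext z
      simp
    rw [this]
    exact W.sum_mem fun j _ => W.smul_mem _ (hhW j)
  · have := congrFun hteq i
    rw [hI0] at this
    exact this

/-! ### First variations and order statistics -/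

/-- Reindexing the coordinates of a tuple by a permutation. -/
def reindex {k : ℕ} (α : Type*) [MeasurableSpace α] (σ : Equiv.Perm (Fin k)) :
    (Fin k → α) ≃ᵐ (Fin k → α) where
  toFun x i := x (σ i)
  invFun x i := x (σ.symm i)
  left_inv x := by simp
  right_inv x := by simp
  measurable_toFun := by
    change Measurable fun (x : Fin k → α) i => x (σ i)
    fun_prop
  measurable_invFun := by
    change Measurable fun (x : Fin k → α) i => x (σ.symm i)
    fun_prop

theorem measurePreserving_reindex {k : ℕ} {α : Type*} [MeasurableSpace α] (μ : Measure α)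
    [IsProbabilityMeasure μ] (σ : Equiv.Perm (Fin k)) :
    MeasurePreserving (reindex α σ) (Measure.pi fun _ => μ) (Measure.pi fun _ => μ) :=
  measurePreserving_comp_injective μ σ σ.injective

/-- The uniform measure on the unit cube. -/
noncomputable def cubeMeasure (k : ℕ) : Measure (Fin k → ℝ) := Measure.pi fun _ => unitMeasure

instance (k : ℕ) : IsProbabilityMeasure (cubeMeasure k) := by unfold cubeMeasure; infer_instance

/-- The increasing tuples. -/
def sortedTuples (k : ℕ) : Set (Fin k → ℝ) := {x | StrictMono x}

theorem measurableSet_sortedTuples (k : ℕ) : MeasurableSet (sortedTuples k) := by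
  have : sortedTuples k = ⋂ i, ⋂ j, ⋂ (_ : i < j), {x : Fin k → ℝ | x i < x j} := by
    ext x
    simp [sortedTuples, StrictMono]
  rw [this]
  exact MeasurableSet.iInter fun i => MeasurableSet.iInter fun j =>
    MeasurableSet.iInter fun _ => measurableSet_lt (by fun_prop) (by fun_prop)

theorem sum_indicator_sortedTuples {k : ℕ} {x : Fin k → ℝ} (hx : Function.Injective x) :
    ∑ σ : Equiv.Perm (Fin k), (sortedTuples k).indicator (fun _ => (1 : ℝ)) (x ∘ σ) = 1 := by
  rw [Finset.sum_eq_single (Tuple.sort x)]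
  · rw [Set.indicator_of_mem]
    exact (Tuple.monotone_sort x).strictMono_of_injective (hx.comp (Tuple.sort x).injective)
  · intro σ _ hσ
    rw [Set.indicator_of_notMem]
    intro h
    have h1 := Tuple.unique_monotone (StrictMono.monotone h) (Tuple.monotone_sort x)
    exact hσ (Equiv.ext fun i => hx (congrFun h1 i))
  · simp

/-- The increasing tuples are a fundamental domain for the permutations of the coordinates. -/
theorem setIntegral_sortedTuples {k : ℕ} {φ : (Fin k → ℝ) → ℝ} (hφ : Measurable φ)
    (hb : ∃ C, ∀ x, |φ x| ≤ C) (hs : ∀ (σ : Equiv.Perm (Fin k)) x, φ (x ∘ σ) = φ x) :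
    ∫ x in sortedTuples k, φ x ∂(cubeMeasure k) =
      (1 / (k.factorial : ℝ)) * ∫ x, φ x ∂(cubeMeasure k) := by
  classical
  obtain ⟨C, hC⟩ := hb
  have hint : Integrable φ (cubeMeasure k) :=
    Integrable.of_bound hφ.aestronglyMeasurable C (ae_of_all _ hC)
  have hmp : ∀ σ : Equiv.Perm (Fin k),
      MeasurePreserving (reindex ℝ σ) (cubeMeasure k) (cubeMeasure k) :=
    fun σ => measurePreserving_reindex unitMeasure σ
  have h1 : ∫ x, φ x ∂(cubeMeasure k) = ∫ x, ∑ σ : Equiv.Perm (Fin k),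
      (sortedTuples k).indicator φ (reindex ℝ σ x) ∂(cubeMeasure k) := by
    refine integral_congr_ae ?_
    filter_upwards [ae_injective unitMeasure measurable_id
      (fun c => by simpa using unitMeasure_singleton c) (ι := Fin k)] with x hx
    have h2 := sum_indicator_sortedTuples (x := x) hx
    rw [← mul_one (φ x), ← h2, Finset.mul_sum]
    refine Finset.sum_congr rfl fun σ _ => ?_
    change φ x * _ = (sortedTuples k).indicator φ (x ∘ σ)
    simp only [Set.indicator_apply, hs]
    split_ifs <;> simp
  rw [h1, integral_finsetSum]
  · rw [Finset.sum_congr rfl fun σ _ => (hmp σ).integral_comp' ((sortedTuples k).indicator φ),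
      integral_indicator (measurableSet_sortedTuples k)]
    simp only [Finset.sum_const, Finset.card_univ, Fintype.card_perm, Fintype.card_fin,
      nsmul_eq_mul]
    have h3 : (0 : ℝ) < k.factorial := by exact_mod_cast k.factorial_pos
    field_simp
  · intro σ _
    exact (hmp σ).integrable_comp_of_integrable (hint.indicator (measurableSet_sortedTuples k))

/-- The two coordinates of uniform points of the square are independent, so that integrals over the
tuples with pattern `p` split. -/
theorem setIntegral_isPattern {k : ℕ} (p : Equiv.Perm (Fin k)) (A B : (Fin k → ℝ) → ℝ) :
    ∫ z in {z | IsPattern p z}, A (fun i => (z i).1) * B (fun i => (z (p.symm i)).2)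
      ∂(Measure.pi fun _ : Fin k => squareMeasure) =
    (∫ x in sortedTuples k, A x ∂(cubeMeasure k)) *
      ∫ y in sortedTuples k, B y ∂(cubeMeasure k) := by
  have h1 := (measurePreserving_arrowProdEquivProdArrow ℝ ℝ (Fin k) (fun _ => unitMeasure)
    (fun _ => unitMeasure)).setIntegral_preimage_emb
    (MeasurableEquiv.measurableEmbedding _)
    (fun w => A w.1 * B (reindex ℝ p.symm w.2))
    (sortedTuples k ×ˢ (reindex ℝ p.symm ⁻¹' sortedTuples k))
  have h2 := setIntegral_prod_mul (μ := cubeMeasure k) (ν := cubeMeasure k) A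
    (fun y => B (reindex ℝ p.symm y)) (sortedTuples k) (reindex ℝ p.symm ⁻¹' sortedTuples k)
  have h3 := (measurePreserving_reindex unitMeasure p.symm).setIntegral_preimage_emb
    (MeasurableEquiv.measurableEmbedding _) B (sortedTuples k)
  change _ = (∫ x in sortedTuples k, A x ∂(cubeMeasure k)) *
    ∫ y in sortedTuples k, B y ∂(Measure.pi fun _ : Fin k => unitMeasure)
  rw [← h3]
  exact h1.trans h2

theorem patternIntegral_one {k : ℕ} (p : Equiv.Perm (Fin k)) :
    patternIntegral p (fun _ => 1) = (1 / (k.factorial : ℝ)) ^ 2 := by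
  have h := setIntegral_isPattern p (fun _ => 1) (fun _ => 1)
  have h1 := setIntegral_sortedTuples (k := k) (φ := fun _ => 1) measurable_const
    ⟨1, by simp⟩ (fun _ _ => rfl)
  rw [h1] at h
  simp only [patternIntegral, Finset.prod_const_one]
  simp only [mul_one] at h
  rw [h]
  simp [sq]

open Polynomial in
/-- The polynomial whose value at `s` is the probability that the `m`-th smallest (counted from
`m = 0`) of `k` independent uniform points of `[0, 1]` is at most `s`. -/
noncomputable def orderStatCDF (k m : ℕ) : ℝ[X] :=
  ∑ j ∈ (Finset.range (k + 1)).filter (fun j => m < j), bernsteinPolynomial ℝ k j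

/-- The indicator of `(-∞, s]`, centred at its mean over `[0, 1]`. -/
noncomputable def stepFun (s x : ℝ) : ℝ := (Set.Iic s).indicator (fun _ => 1) x - s

theorem measurable_stepFun (s : ℝ) : Measurable (stepFun s) :=
  (measurable_const.indicator measurableSet_Iic).sub measurable_const

theorem abs_stepFun_le {s : ℝ} (hs : s ∈ Set.Icc (0 : ℝ) 1) (x : ℝ) : |stepFun s x| ≤ 1 := by
  classical
  unfold stepFun
  rw [Set.indicator_apply, abs_le]
  split_ifs <;> constructor <;> linarith [hs.1, hs.2]

theorem unitMeasure_real_Iic {s : ℝ} (hs : s ∈ Set.Icc (0 : ℝ) 1) :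
    unitMeasure.real (Set.Iic s) = s := by
  rw [measureReal_def, unitMeasure, Measure.restrict_apply measurableSet_Iic]
  have : Set.Iic s ∩ Set.Icc 0 1 = Set.Icc 0 s := by
    ext x
    simp only [Set.mem_inter_iff, Set.mem_Iic, Set.mem_Icc]
    constructor
    · rintro ⟨h1, h2, h3⟩; exact ⟨h2, h1⟩
    · rintro ⟨h1, h2⟩; exact ⟨h2, h1, h2.trans hs.2⟩
  rw [this, Real.volume_Icc, sub_zero, ENNReal.toReal_ofReal hs.1]

theorem integrable_indicator_Iic (s : ℝ) :
    Integrable ((Set.Iic s).indicator fun _ => (1 : ℝ)) unitMeasure :=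
  (integrable_const _).indicator measurableSet_Iic

theorem integral_indicator_Iic {s : ℝ} (hs : s ∈ Set.Icc (0 : ℝ) 1) :
    ∫ x, (Set.Iic s).indicator (fun _ => (1 : ℝ)) x ∂unitMeasure = s := by
  rw [integral_indicator_const _ measurableSet_Iic, unitMeasure_real_Iic hs]
  simp

theorem integral_stepFun {s : ℝ} (hs : s ∈ Set.Icc (0 : ℝ) 1) :
    ∫ x, stepFun s x ∂unitMeasure = 0 := by
  unfold stepFun
  rw [integral_sub (integrable_indicator_Iic s) (integrable_const _), integral_indicator_Iic hs]
  simp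

theorem stepFun_mul_mem_balanced {s u : ℝ} (hs : s ∈ Set.Icc (0 : ℝ) 1)
    (hu : u ∈ Set.Icc (0 : ℝ) 1) : (fun z : ℝ × ℝ => stepFun s z.1 * stepFun u z.2) ∈ balanced := by
  refine ⟨((measurable_stepFun s).comp measurable_fst).mul
    ((measurable_stepFun u).comp measurable_snd), ⟨1, fun z => ?_⟩, ?_⟩
  · rw [abs_mul]
    exact mul_le_one₀ (abs_stepFun_le hs _) (abs_nonneg _) (abs_stepFun_le hu _)
  · rw [squareMeasure, integral_prod_mul, integral_stepFun hs, zero_mul]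

open Classical in
theorem integral_card_filter_le {k : ℕ} {s : ℝ} (hs : s ∈ Set.Icc (0 : ℝ) 1) (m : ℕ) :
    ∫ x : Fin k → ℝ, (if m < (Finset.univ.filter fun i => x i ≤ s).card then (1 : ℝ) else 0)
      ∂(cubeMeasure k) = (orderStatCDF k m).eval s := by
  -- Split according to the set `J` of the coordinates that are at most `s`.
  have h1 : ∀ x : Fin k → ℝ,
      (if m < (Finset.univ.filter fun i => x i ≤ s).card then (1 : ℝ) else 0) =
      ∑ J : Finset (Fin k), (if m < J.card then (1 : ℝ) else 0) *
        ∏ i, (if i ∈ J then (Set.Iic s).indicator (fun _ => (1 : ℝ)) (x i) else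
          1 - (Set.Iic s).indicator (fun _ => (1 : ℝ)) (x i)) := by
    intro x
    rw [Finset.sum_eq_single (Finset.univ.filter fun i => x i ≤ s)]
    · rw [Finset.prod_eq_one, mul_one]
      intro i _
      by_cases h : x i ≤ s <;> simp [h]
    · intro J _ hJ
      have : ∃ i, ¬ (i ∈ J ↔ x i ≤ s) := by
        by_contra hcon
        push Not at hcon
        exact hJ (Finset.ext fun i => by simp [hcon i])
      obtain ⟨i, hi⟩ := this
      rw [Finset.prod_eq_zero (Finset.mem_univ i), mul_zero]
      by_cases h : i ∈ J <;> by_cases h' : x i ≤ s <;> simp_all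
    · simp
  have h2 : ∀ J : Finset (Fin k), ∫ x : Fin k → ℝ,
      ∏ i, (if i ∈ J then (Set.Iic s).indicator (fun _ => (1 : ℝ)) (x i) else
          1 - (Set.Iic s).indicator (fun _ => (1 : ℝ)) (x i)) ∂(cubeMeasure k) =
      s ^ J.card * (1 - s) ^ (k - J.card) := by
    intro J
    have h3 := integral_fintype_prod_eq_prod (μ := fun _ : Fin k => unitMeasure)
      (fun (i : Fin k) (y : ℝ) => if i ∈ J then (Set.Iic s).indicator (fun _ => (1 : ℝ)) y else
          1 - (Set.Iic s).indicator (fun _ => (1 : ℝ)) y)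
    rw [cubeMeasure, h3]
    have h4 : ∀ i : Fin k, ∫ y, (if i ∈ J then (Set.Iic s).indicator (fun _ => (1 : ℝ)) y else
        1 - (Set.Iic s).indicator (fun _ => (1 : ℝ)) y) ∂unitMeasure =
        if i ∈ J then s else 1 - s := by
      intro i
      split_ifs
      · exact integral_indicator_Iic hs
      · rw [integral_sub (integrable_const _) (integrable_indicator_Iic s),
          integral_indicator_Iic hs]
        simp
    simp only [h4]
    rw [Finset.prod_ite]
    simp only [Finset.prod_const, Finset.filter_mem_eq_inter, Finset.univ_inter]
    congr 2
    rw [Finset.filter_not, Finset.filter_mem_eq_inter, Finset.univ_inter, Finset.card_univ_sdiff,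
      Fintype.card_fin]
  simp only [h1]
  rw [integral_finsetSum]
  · simp only [integral_const_mul, h2]
    have h5 := Finset.sum_powerset_apply_card (x := (Finset.univ : Finset (Fin k)))
      (fun j => (if m < j then (1 : ℝ) else 0) *
      (s ^ j * (1 - s) ^ (k - j)))
    rw [Finset.powerset_univ] at h5
    rw [h5, orderStatCDF, Polynomial.eval_finsetSum, Finset.sum_filter]
    simp only [Finset.card_univ, Fintype.card_fin]
    refine Finset.sum_congr rfl fun j _ => ?_
    split_ifs
    · simp [bernsteinPolynomial]
      ring
    · simp
  · intro J _
    refine Integrable.const_mul ?_ _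
    refine Integrable.of_bound (C := 1) (Measurable.aestronglyMeasurable ?_)
      (ae_of_all _ fun x => ?_)
    · refine Finset.measurable_fun_prod _ fun i _ => ?_
      have hm : Measurable fun x : Fin k → ℝ =>
          (Set.Iic s).indicator (fun _ => (1 : ℝ)) (x i) :=
        (measurable_const.indicator measurableSet_Iic).comp (measurable_pi_apply i)
      split_ifs
      · exact hm
      · exact measurable_const.sub hm
    · rw [Real.norm_eq_abs, Finset.abs_prod]
      refine Finset.prod_le_one (fun i _ => abs_nonneg _) fun i _ => ?_
      by_cases h : i ∈ J <;> by_cases h' : x i ≤ s <;> simp [h, h']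

theorem setIntegral_stepFun {k : ℕ} {s : ℝ} (hs : s ∈ Set.Icc (0 : ℝ) 1) (m : Fin k) :
    ∫ x in sortedTuples k, stepFun s (x m) ∂(cubeMeasure k) =
      (1 / (k.factorial : ℝ)) * ((orderStatCDF k m).eval s - s) := by
  classical
  have hmeas : Measurable fun x : Fin k → ℝ =>
      (if (m : ℕ) < (Finset.univ.filter fun i => x i ≤ s).card then (1 : ℝ) else 0) := by
    have h1 : Measurable fun x : Fin k → ℝ => (Finset.univ.filter fun i => x i ≤ s).card := by
      simp only [Finset.card_filter]
      exact Finset.measurable_fun_sum _ fun i _ => Measurable.ite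
        (measurableSet_le (by fun_prop) measurable_const) measurable_const measurable_const
    exact Measurable.ite (measurableSet_lt measurable_const h1) measurable_const measurable_const
  have hbd : ∀ x : Fin k → ℝ,
      |(if (m : ℕ) < (Finset.univ.filter fun i => x i ≤ s).card then (1 : ℝ) else 0) - s| ≤ 1 := by
    intro x
    rw [abs_le]
    split_ifs <;> constructor <;> linarith [hs.1, hs.2]
  have h1 : ∫ x in sortedTuples k, stepFun s (x m) ∂(cubeMeasure k) =
      ∫ x in sortedTuples k,
        ((if (m : ℕ) < (Finset.univ.filter fun i => x i ≤ s).card then (1 : ℝ) else 0) - s)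
        ∂(cubeMeasure k) := by
    refine setIntegral_congr_fun (measurableSet_sortedTuples k) fun x hx => ?_
    have h2 := Tuple.lt_card_le_iff_apply_le_of_monotone (j := m) (a := s) (StrictMono.monotone hx)
    simp only [stepFun, Set.indicator_apply, Set.mem_Iic]
    congr 1
    by_cases h : x m ≤ s
    · rw [if_pos h, if_pos (h2.2 h)]
    · rw [if_neg h, if_neg (fun h' => h (h2.1 h'))]
  have hmeas' : Measurable fun x : Fin k → ℝ =>
      (if (m : ℕ) < (Finset.univ.filter fun i => x i ≤ s).card then (1 : ℝ) else 0) - s :=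
    hmeas.sub measurable_const
  rw [h1, setIntegral_sortedTuples hmeas' ⟨1, hbd⟩]
  · rw [integral_sub, integral_card_filter_le hs]
    · simp
    · refine Integrable.of_bound (C := 1) hmeas.aestronglyMeasurable (ae_of_all _ fun x => ?_)
      split_ifs <;> simp
    · exact integrable_const _
  · intro σ x
    have : (Finset.univ.filter fun i => (x ∘ σ) i ≤ s).card =
        (Finset.univ.filter fun i => x i ≤ s).card := by
      rw [← Finset.card_map σ.toEmbedding]
      congr 1
      ext i
      simp only [Finset.mem_map_equiv, Finset.mem_filter, Finset.mem_univ, true_and,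
        Function.comp_apply, Equiv.apply_symm_apply]
    rw [this]

theorem firstVariation_stepFun {k : ℕ} (p : Equiv.Perm (Fin k)) {s u : ℝ}
    (hs : s ∈ Set.Icc (0 : ℝ) 1) (hu : u ∈ Set.Icc (0 : ℝ) 1) :
    firstVariation p (fun z => stepFun s z.1 * stepFun u z.2) = (1 / (k.factorial : ℝ)) ^ 2 *
      ∑ m : Fin k, ((orderStatCDF k m).eval s - s) * ((orderStatCDF k (p m)).eval u - u) := by
  rw [firstVariation, Finset.mul_sum]
  refine Finset.sum_congr rfl fun m _ => ?_
  have h := setIntegral_isPattern p (fun x => stepFun s (x m)) (fun y => stepFun u (y (p m)))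
  simp only [Equiv.symm_apply_apply] at h
  rw [h, setIntegral_stepFun hs, setIntegral_stepFun hu]
  ring

/-! ### Bernstein polynomials and permutation matrices -/

section BernsteinRelations

open Polynomial

theorem derivative_orderStatCDF {k m : ℕ} (hm : m < k) :
    derivative (orderStatCDF k m) = (k : ℝ[X]) * bernsteinPolynomial ℝ (k - 1) m := by
  have h1 : ∀ r, r < k → derivative (∑ j ∈ Finset.range (r + 1), bernsteinPolynomial ℝ k j) =
      - ((k : ℝ[X]) * bernsteinPolynomial ℝ (k - 1) r) := by
    intro r hr
    induction r with
    | zero => simp [bernsteinPolynomial.derivative_zero]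
    | succ r ih =>
      rw [Finset.sum_range_succ, derivative_add, ih (by omega),
        bernsteinPolynomial.derivative_succ]
      ring
  have h2 : orderStatCDF k m = 1 - ∑ j ∈ Finset.range (m + 1), bernsteinPolynomial ℝ k j := by
    rw [orderStatCDF, ← bernsteinPolynomial.sum ℝ k,
      ← Finset.sum_filter_add_sum_filter_not (Finset.range (k + 1)) (fun j => m < j)]
    have : (Finset.range (k + 1)).filter (fun j => ¬ m < j) = Finset.range (m + 1) := by
      ext j
      simp only [Finset.mem_filter, Finset.mem_range]
      omega
    rw [this]
    ring
  rw [h2, derivative_sub, h1 m hm]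
  simp

theorem eq_zero_of_eval_Icc {P : ℝ[X]} (h : ∀ s ∈ Set.Icc (0 : ℝ) 1, P.eval s = 0) : P = 0 :=
  Polynomial.eq_zero_of_infinite_isRoot P
    ((Set.Icc_infinite (zero_lt_one' ℝ)).mono fun s hs => h s hs)

/-- Mixed partial derivatives of a polynomial identity on the unit square. -/
theorem sum_derivative_mul_derivative_eq_zero {ι : Type*} (T : Finset ι) (P Q : ι → ℝ[X])
    (h : ∀ s ∈ Set.Icc (0 : ℝ) 1, ∀ u ∈ Set.Icc (0 : ℝ) 1,
      ∑ i ∈ T, (P i).eval s * (Q i).eval u = 0) (s u : ℝ) :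
    ∑ i ∈ T, (derivative (P i)).eval s * (derivative (Q i)).eval u = 0 := by
  have h1 : ∀ u ∈ Set.Icc (0 : ℝ) 1, ∑ i ∈ T, (derivative (P i)).eval s * (Q i).eval u = 0 := by
    intro u hu
    have h2 : ∑ i ∈ T, P i * C ((Q i).eval u) = 0 := eq_zero_of_eval_Icc fun s hs => by
      simpa [eval_finsetSum] using h s hs u hu
    have h3 := congrArg (fun R => (derivative R).eval s) h2
    simpa [eval_finsetSum, derivative_sum] using h3
  have h2 : ∑ i ∈ T, C ((derivative (P i)).eval s) * Q i = 0 := eq_zero_of_eval_Icc fun u hu => by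
    simpa [eval_finsetSum] using h1 u hu
  have h3 := congrArg (fun R => (derivative R).eval u) h2
  simpa [eval_finsetSum, derivative_sum] using h3

/-- The Bernstein basis polynomial of degree `k - 1` attached to a position `m` of a permutation of
order `k`; up to the factor `k`, it is the density of the `m`-th smallest of `k` uniform points. -/
noncomputable def bern {k : ℕ} (m : Fin k) : ℝ[X] := bernsteinPolynomial ℝ (k - 1) m

theorem coeff_bern {k : ℕ} (m : Fin k) (d : ℕ) : (bern m).coeff d =
    if (m : ℕ) ≤ d then (-1 : ℝ) ^ (d - m) * (k - 1).choose m * (k - 1 - m).choose (d - m)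
    else 0 := by
  have h1 : ∀ r i : ℕ, ((1 - X : ℝ[X]) ^ r).coeff i = (-1) ^ i * r.choose i := by
    intro r i
    have h2 : (1 - X : ℝ[X]) ^ r = ((1 + X) ^ r).comp (C (-1) * X) := by simp [sub_eq_add_neg]
    rw [h2, comp_C_mul_X_coeff, coeff_one_add_X_pow, mul_comm]
  rw [bern, bernsteinPolynomial, mul_assoc, ← C_eq_natCast, coeff_C_mul, coeff_X_pow_mul']
  split_ifs
  · rw [h1]
    ring
  · simp

theorem sum_bern {k : ℕ} (hk : 0 < k) : ∑ m : Fin k, bern m = 1 := by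
  obtain ⟨k, rfl⟩ : ∃ l, k = l + 1 := ⟨k - 1, by omega⟩
  rw [← bernsteinPolynomial.sum ℝ k]
  exact Fin.sum_univ_eq_sum_range (fun j => bernsteinPolynomial ℝ k j) (k + 1)

theorem eq_of_sum_mul_bern_eval {k : ℕ} {x y : Fin k → ℝ}
    (h : ∀ s : ℝ, ∑ m, x m * (bern m).eval s = ∑ m, y m * (bern m).eval s) : x = y := by
  have hz : ∑ m, C (x m - y m) * bern m = 0 := by
    refine Polynomial.funext fun s => ?_
    have := h s
    simp only [eval_finsetSum, eval_mul, eval_C, eval_zero, sub_mul, Finset.sum_sub_distrib]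
    linarith
  have hx : ∀ n (m : Fin k), (m : ℕ) = n → x m - y m = 0 := by
    intro n
    induction n using Nat.strong_induction_on with
    | _ n ih =>
      rintro m rfl
      have h1 := congrArg (fun P => coeff P (m : ℕ)) hz
      simp only [finsetSum_coeff, coeff_C_mul, coeff_zero] at h1
      rw [Finset.sum_eq_single m] at h1
      · rw [coeff_bern, if_pos le_rfl] at h1
        have h2 : (0 : ℝ) < (k - 1).choose m := by
          exact_mod_cast Nat.choose_pos (by have := m.2; omega)
        simpa [h2.ne'] using h1
      · intro j _ hj
        rcases lt_or_gt_of_ne hj with hlt | hgt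
        · rw [ih j hlt j rfl, zero_mul]
        · rw [coeff_bern, if_neg (by simpa using hgt), mul_zero]
      · simp
  exact funext fun m => sub_eq_zero.1 (hx m m rfl)

/-- The kernel of the mixed derivative of the first variation of `p`: the permutation matrix of `p`
written in the Bernstein basis. -/
noncomputable def permKernel (p : FinPerm) (s u : ℝ) : ℝ :=
  ∑ m : Fin p.1, (bern m).eval s * (bern (p.2 m)).eval u

/-- A linear relation between first variations is a linear relation, modulo constants, between
permutation matrices in Bernstein bases. -/
theorem sum_mul_permKernel_eq {ι : Type*} (T : Finset ι) (p : ι → FinPerm) (β : ι → ℝ)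
    (h : ∀ s ∈ Set.Icc (0 : ℝ) 1, ∀ u ∈ Set.Icc (0 : ℝ) 1, ∑ i ∈ T, β i *
      firstVariation (p i).2 (fun z => stepFun s z.1 * stepFun u z.2) = 0) :
    ∃ c : ℝ, ∀ s u : ℝ, ∑ i ∈ T, (β i * ((p i).1 / ((p i).1.factorial : ℝ)) ^ 2) *
      permKernel (p i) s u = c := by
  have h1 := sum_derivative_mul_derivative_eq_zero
    (T.sigma fun i => (Finset.univ : Finset (Fin (p i).1)))
    (fun x => C (β x.1 * (1 / ((p x.1).1.factorial : ℝ)) ^ 2) * (orderStatCDF (p x.1).1 x.2 - X))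
    (fun x => orderStatCDF (p x.1).1 ((p x.1).2 x.2) - X) (by
      intro s hs u hu
      rw [Finset.sum_sigma, ← h s hs u hu]
      refine Finset.sum_congr rfl fun i _ => ?_
      rw [firstVariation_stepFun _ hs hu, Finset.mul_sum, Finset.mul_sum]
      refine Finset.sum_congr rfl fun m _ => ?_
      simp
      ring)
  refine ⟨∑ i ∈ T, β i * (1 / ((p i).1.factorial : ℝ)) ^ 2 * (p i).1, fun s u => ?_⟩
  rw [← sub_eq_zero, ← Finset.sum_sub_distrib, ← h1 s u, Finset.sum_sigma]
  refine Finset.sum_congr rfl fun i _ => ?_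
  suffices key : ∀ (k : ℕ) (q : Equiv.Perm (Fin k)) (b : ℝ),
      b * (k / (k.factorial : ℝ)) ^ 2 * permKernel ⟨k, q⟩ s u -
        b * (1 / (k.factorial : ℝ)) ^ 2 * k =
      ∑ m : Fin k, (derivative (C (b * (1 / (k.factorial : ℝ)) ^ 2) *
        (orderStatCDF k m - X))).eval s * (derivative (orderStatCDF k (q m) - X)).eval u from
    key (p i).1 (p i).2 (β i)
  intro k q b
  rcases Nat.eq_zero_or_pos k with rfl | hk
  · simp [permKernel]
  have h2 : ∀ m : Fin k, (derivative (C (b * (1 / (k.factorial : ℝ)) ^ 2) *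
      (orderStatCDF k m - X))).eval s * (derivative (orderStatCDF k (q m) - X)).eval u =
      b * (1 / (k.factorial : ℝ)) ^ 2 * (k ^ 2 * ((bern m).eval s * (bern (q m)).eval u)
        - k * (bern m).eval s - k * (bern (q m)).eval u + 1) := by
    intro m
    rw [derivative_C_mul, derivative_sub, derivative_sub,
      derivative_orderStatCDF m.2, derivative_orderStatCDF (q m).2]
    simp [bern]
    ring
  have h3 : ∀ v : ℝ, ∑ m : Fin k, (bern m).eval v = 1 := by
    intro v
    rw [← eval_finsetSum, sum_bern hk, eval_one]
  have h4 : ∑ m : Fin k, (bern (q m)).eval u = 1 := by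
    rw [← h3 u]
    exact Equiv.sum_comp q fun m => (bern m).eval u
  rw [Finset.sum_congr rfl fun m _ => h2 m, ← Finset.mul_sum, Finset.sum_add_distrib,
    Finset.sum_sub_distrib, Finset.sum_sub_distrib, ← Finset.mul_sum, ← Finset.mul_sum,
    ← Finset.mul_sum, h3, h4]
  simp [permKernel]
  ring

/-! ### Linear relations between first variations -/

theorem bern_eval_zero {k : ℕ} (m : Fin k) :
    (bern m).eval 0 = if (m : ℕ) = 0 then 1 else 0 := bernsteinPolynomial.eval_at_0 ℝ _ _

theorem bern_eval_one {k : ℕ} (m : Fin k) :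
    (bern m).eval 1 = if (m : ℕ) = k - 1 then 1 else 0 := bernsteinPolynomial.eval_at_1 ℝ _ _

theorem coeff_bern_of_le {k : ℕ} (m : Fin k) {d : ℕ} (hd : k ≤ d) : (bern m).coeff d = 0 := by
  rw [coeff_bern]
  split_ifs
  · rw [Nat.choose_eq_zero_of_lt (n := k - 1 - m) (by have := m.2; omega)]
    simp
  · rfl

theorem coeff_bern_top {k : ℕ} (m : Fin k) :
    (bern m).coeff (k - 1) = (-1) ^ (k - 1 - m) * (k - 1).choose m := by
  rw [coeff_bern, if_pos (by have := m.2; omega), Nat.choose_self]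
  simp

theorem abs_coeff_bern_top {k : ℕ} (m : Fin k) :
    |(bern m).coeff (k - 1)| = (k - 1).choose m := by
  rw [coeff_bern_top, abs_mul, abs_pow]
  simp

theorem coeff_bern_top_ne_zero {k : ℕ} (m : Fin k) : (bern m).coeff (k - 1) ≠ 0 := by
  rw [← abs_pos, abs_coeff_bern_top]
  exact_mod_cast Nat.choose_pos (by have := m.2; omega)

theorem permKernel_zero_left {k : ℕ} (π : Equiv.Perm (Fin k)) (h : 0 < k) (u : ℝ) :
    permKernel ⟨k, π⟩ 0 u = (bern (π ⟨0, h⟩)).eval u := by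
  rw [permKernel, Finset.sum_eq_single ⟨0, h⟩]
  · simp [bern_eval_zero]
  · intro m _ hm
    rw [bern_eval_zero, if_neg (fun h0 => hm (Fin.ext h0)), zero_mul]
  · simp

theorem permKernel_one_left {k : ℕ} (π : Equiv.Perm (Fin k)) (h : k - 1 < k) (u : ℝ) :
    permKernel ⟨k, π⟩ 1 u = (bern (π ⟨k - 1, h⟩)).eval u := by
  rw [permKernel, Finset.sum_eq_single ⟨k - 1, h⟩]
  · simp [bern_eval_one]
  · intro m _ hm
    rw [bern_eval_one, if_neg (fun h0 => hm (Fin.ext h0)), zero_mul]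
  · simp

theorem sum_comp_perm {k : ℕ} (π : Equiv.Perm (Fin k)) (x : Fin k → ℝ) (u : ℝ) :
    ∑ m, x m * (bern (π m)).eval u = ∑ j, x (π.symm j) * (bern j).eval u := by
  rw [← Equiv.sum_comp π fun j => x (π.symm j) * (bern j).eval u]
  simp only [Equiv.symm_apply_apply]

theorem const_eq_sum_bern {k : ℕ} (hk : 0 < k) (c u : ℝ) :
    c = ∑ m : Fin k, c * (bern m).eval u := by
  rw [← Finset.mul_sum, ← eval_finsetSum, sum_bern hk, eval_one, mul_one]

/-- Extracting a nonconstant coefficient in the first variable of a relation. -/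
theorem sum_coeff_eq_zero {T : Finset FinPerm} {γ : FinPerm → ℝ} {c : ℝ}
    (h : ∀ s u : ℝ, ∑ p ∈ T, γ p * permKernel p s u = c) {d : ℕ} (hd : 0 < d) (u : ℝ) :
    ∑ p ∈ T, γ p * ∑ m : Fin p.1, (bern m).coeff d * (bern (p.2 m)).eval u = 0 := by
  have h1 : ∑ p ∈ T, C (γ p) * ∑ m : Fin p.1, C ((bern (p.2 m)).eval u) * bern m = C c := by
    refine Polynomial.funext fun s => ?_
    rw [eval_C, ← h s u, eval_finsetSum]
    refine Finset.sum_congr rfl fun p _ => ?_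
    simp [eval_finsetSum, permKernel, mul_comm]
  have h2 := congrArg (fun P => coeff P d) h1
  simp only [finsetSum_coeff, coeff_C_mul, coeff_C, if_neg hd.ne'] at h2
  rw [← h2]
  simp only [mul_comm]

/-- A pattern longer than all the others cannot take part in a relation. -/
theorem coeff_eq_zero_of_order_lt {T : Finset FinPerm} {γ : FinPerm → ℝ} {c : ℝ}
    (h : ∀ s u : ℝ, ∑ p ∈ T, γ p * permKernel p s u = c) {p : FinPerm} (hp : p ∈ T)
    (hp2 : 2 ≤ p.1) (hlt : ∀ q ∈ T, q ≠ p → q.1 < p.1) : γ p = 0 := by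
  have h1 : ∀ u : ℝ, ∑ j, (γ p * (bern (p.2.symm j)).coeff (p.1 - 1)) * (bern j).eval u =
      ∑ j : Fin p.1, (0 : ℝ) * (bern j).eval u := by
    intro u
    have h2 := sum_coeff_eq_zero h (d := p.1 - 1) (by omega) u
    rw [Finset.sum_eq_single p] at h2
    · rw [sum_comp_perm p.2 (fun m => (bern m).coeff (p.1 - 1)), Finset.mul_sum] at h2
      simpa [mul_assoc] using h2
    · intro q hq hne
      have := hlt q hq hne
      rw [Finset.sum_eq_zero, mul_zero]
      intro m _
      rw [coeff_bern_of_le m (by omega), zero_mul]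
    · exact fun h => absurd hp h
  have h3 := congrFun (eq_of_sum_mul_bern_eval h1) (⟨0, by omega⟩ : Fin p.1)
  exact (mul_eq_zero.1 h3).resolve_right (coeff_bern_top_ne_zero _)

theorem matrix_relation {k : ℕ} (hk : 0 < k) {π σ τ : Equiv.Perm (Fin k)} {a b d c : ℝ}
    (h : ∀ s u : ℝ, a * permKernel ⟨k, π⟩ s u + b * permKernel ⟨k, σ⟩ s u +
      d * permKernel ⟨k, τ⟩ s u = c) (i j : Fin k) :
    a * (if j = π i then 1 else 0) + b * (if j = σ i then 1 else 0) +
      d * (if j = τ i then 1 else 0) = c := by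
  have h1 : ∀ u,
      a * (bern (π i)).eval u + b * (bern (σ i)).eval u + d * (bern (τ i)).eval u = c := by
    intro u
    have := eq_of_sum_mul_bern_eval (k := k)
      (x := fun m => a * (bern (π m)).eval u + b * (bern (σ m)).eval u + d * (bern (τ m)).eval u)
      (y := fun _ => c) (fun s => by
        rw [← const_eq_sum_bern hk, ← h s u]
        simp only [permKernel, Finset.mul_sum, ← Finset.sum_add_distrib]
        exact Finset.sum_congr rfl fun m _ => by ring)
    exact congrFun this i
  have h2 := eq_of_sum_mul_bern_eval (k := k)
      (x := fun j => a * (if j = π i then 1 else 0) + b * (if j = σ i then 1 else 0) +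
        d * (if j = τ i then 1 else 0))
      (y := fun _ => c) (fun u => by
        rw [← const_eq_sum_bern hk, ← h1 u]
        simp [add_mul, Finset.sum_add_distrib])
  exact congrFun h2 j

theorem exists_fin_ne_ne {k : ℕ} (hk : 3 ≤ k) (a b : Fin k) : ∃ j, j ≠ a ∧ j ≠ b := by
  have : ∃ j ∈ (Finset.univ : Finset (Fin k)), j ∉ ({a, b} : Finset (Fin k)) := by
    refine Finset.exists_mem_notMem_of_card_lt_card ?_
    rw [Finset.card_univ, Fintype.card_fin]
    exact lt_of_le_of_lt Finset.card_le_two (by omega)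
  obtain ⟨j, -, hj⟩ := this
  exact ⟨j, by simpa [not_or] using hj⟩

theorem exists_fin_ne_ne_ne {k : ℕ} (hk : 4 ≤ k) (a b c : Fin k) :
    ∃ j, j ≠ a ∧ j ≠ b ∧ j ≠ c := by
  have : ∃ j ∈ (Finset.univ : Finset (Fin k)), j ∉ ({a, b, c} : Finset (Fin k)) := by
    refine Finset.exists_mem_notMem_of_card_lt_card ?_
    rw [Finset.card_univ, Fintype.card_fin]
    exact lt_of_le_of_lt Finset.card_le_three (by omega)
  obtain ⟨j, -, hj⟩ := this
  exact ⟨j, by simpa [not_or] using hj⟩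

/-- No combination of at most three permutation matrices, with distinct `π` and `σ` occurring in it,
is a multiple of the all-one matrix if the size of the matrices exceeds their number. -/
theorem no_relation_same_order {k : ℕ} {π σ τ : Equiv.Perm (Fin k)} {a b d c : ℝ}
    (h : ∀ s u : ℝ, a * permKernel ⟨k, π⟩ s u + b * permKernel ⟨k, σ⟩ s u +
      d * permKernel ⟨k, τ⟩ s u = c) (hk : 4 ≤ k ∨ (3 ≤ k ∧ d = 0)) (hne : π ≠ σ)
    (ha : a ≠ 0) (hb : b ≠ 0) : False := by
  have hM := matrix_relation (by omega) h
  have hc : c = 0 := by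
    have i : Fin k := ⟨0, by omega⟩
    rcases hk with hk | ⟨hk, rfl⟩
    · obtain ⟨j, h1, h2, h3⟩ := exists_fin_ne_ne_ne hk (π i) (σ i) (τ i)
      simpa [h1, h2, h3] using (hM i j).symm
    · obtain ⟨j, h1, h2⟩ := exists_fin_ne_ne hk (π i) (σ i)
      simpa [h1, h2] using (hM i j).symm
  obtain ⟨i, hi⟩ : ∃ i, π i ≠ σ i := by
    by_contra hcon
    push Not at hcon
    exact hne (Equiv.ext hcon)
  have h1 := hM i (π i)
  have h2 := hM i (σ i)
  rw [hc, if_pos rfl, if_neg hi] at h1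
  rw [hc, if_pos rfl, if_neg hi.symm] at h2
  by_cases h3 : π i = τ i
  · rw [if_neg (fun h4 => hi (h3.trans h4.symm))] at h2
    exact hb (by linarith)
  · rw [if_neg h3] at h1
    exact ha (by linarith)

/-- Extracting a coefficient of degree at least the order of the third permutation. -/
theorem coeff_relation {k l : ℕ} {π σ : Equiv.Perm (Fin k)} {τ : Equiv.Perm (Fin l)} {a b d c : ℝ}
    (h : ∀ s u : ℝ, a * permKernel ⟨k, π⟩ s u + b * permKernel ⟨k, σ⟩ s u +
      d * permKernel ⟨l, τ⟩ s u = c) {e : ℕ} (he : 0 < e) (hle : l ≤ e) (j : Fin k) :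
    a * (bern (π.symm j)).coeff e + b * (bern (σ.symm j)).coeff e = 0 := by
  have h1 : ∀ u : ℝ, a * ∑ m, (bern m).coeff e * (bern (π m)).eval u +
      b * ∑ m, (bern m).coeff e * (bern (σ m)).eval u = 0 := by
    intro u
    have h2 : C a * ∑ m, C ((bern (π m)).eval u) * bern m +
        C b * ∑ m, C ((bern (σ m)).eval u) * bern m +
        C d * ∑ m, C ((bern (τ m)).eval u) * bern m = C c := by
      refine Polynomial.funext fun s => ?_
      rw [eval_C, ← h s u]
      simp [eval_finsetSum, permKernel, mul_comm]
    have h3 := congrArg (fun P => coeff P e) h2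
    simp only [coeff_add, finsetSum_coeff, coeff_C_mul, coeff_C, if_neg he.ne'] at h3
    have h4 : ∑ m, (bern (τ m)).eval u * (bern m).coeff e = 0 :=
      Finset.sum_eq_zero fun m _ => by rw [coeff_bern_of_le m hle, mul_zero]
    rw [h4, mul_zero, add_zero] at h3
    rw [← h3]
    simp only [mul_comm]
  have h5 := eq_of_sum_mul_bern_eval (k := k)
    (x := fun j => a * (bern (π.symm j)).coeff e + b * (bern (σ.symm j)).coeff e)
    (y := fun _ => 0) (fun u => by
      have := h1 u
      rw [sum_comp_perm π (fun m => (bern m).coeff e),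
        sum_comp_perm σ (fun m => (bern m).coeff e)] at this
      simp only [add_mul, Finset.sum_add_distrib, zero_mul, Finset.sum_const_zero, mul_assoc,
        ← Finset.mul_sum]
      exact this)
  exact congrFun h5 j

theorem eq_zero_of_mul_bern_eval_const {l : ℕ} (hl : 2 ≤ l) (i : Fin l) {d c : ℝ}
    (h : ∀ u : ℝ, d * (bern i).eval u = c) : d = 0 := by
  have h1 := eq_of_sum_mul_bern_eval (k := l) (x := fun j => d * (if j = i then 1 else 0))
    (y := fun _ => c) (fun u => by
      rw [← const_eq_sum_bern (by omega), ← h u]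
      simp)
  obtain ⟨j, hj⟩ : ∃ j : Fin l, j ≠ i := by
    have : Nontrivial (Fin l) := Fin.nontrivial_iff_two_le.2 hl
    exact exists_ne i
  have h2 := congrFun h1 i
  have h3 := congrFun h1 j
  simp only [if_true, if_neg hj, mul_zero, mul_one] at h2 h3
  rw [h2, ← h3]

theorem eq_zero_or_eq_of_choose_eq_one {n i : ℕ} (h : n.choose i = 1) : i = 0 ∨ i = n :=
  (Nat.choose_eq_one_iff.1 h).imp_right Eq.symm

/-- Two distinct permutations of order `k ≥ 4` and a shorter one satisfy no relation. Comparing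
leading coefficients, the two long permutations send the pair of ends `{0, k - 1}` to the same pair
of values. If an end has the same value under both, evaluating the relation there isolates the short
permutation. Otherwise the values at the ends are swapped; if `l = k - 1`, a combination of the
relation at both ends isolates the short permutation, and if `l ≤ k - 2`, the coefficients of degree
`k - 2`, which vanish at one end only, give a contradiction. -/
theorem no_relation_shorter {k l : ℕ} {π σ : Equiv.Perm (Fin k)} {τ : Equiv.Perm (Fin l)}
    {a b d c : ℝ}
    (h : ∀ s u : ℝ, a * permKernel ⟨k, π⟩ s u + b * permKernel ⟨k, σ⟩ s u +
      d * permKernel ⟨l, τ⟩ s u = c) (hk : 4 ≤ k) (hl : 2 ≤ l) (hlk : l < k)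
    (ha : a ≠ 0) (hd : d ≠ 0) : False := by
  have hk0 : 0 < k := by omega
  have hk1 : k - 1 < k := by omega
  have hl0 : 0 < l := by omega
  have hl1 : l - 1 < l := by omega
  have hu := coeff_relation h (e := k - 1) (by omega) (by omega)
  -- The leading coefficients of the Bernstein polynomials are binomial coefficients up to sign, and
  -- the two ends are the positions where they are `±1`.
  have habs : ∀ j, |a| * ((k - 1).choose (π.symm j) : ℝ) =
      |b| * ((k - 1).choose (σ.symm j) : ℝ) := by
    intro j
    rw [← abs_coeff_bern_top, ← abs_coeff_bern_top, ← abs_mul, ← abs_mul,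
      eq_neg_of_add_eq_zero_left (hu j), abs_neg]
  have hab : |a| = |b| := by
    have h1 : ∑ j, |a| * ((k - 1).choose (π.symm j) : ℝ) =
        ∑ j, |b| * ((k - 1).choose (σ.symm j) : ℝ) := Finset.sum_congr rfl fun j _ => habs j
    rw [← Finset.mul_sum, ← Finset.mul_sum,
      Equiv.sum_comp π.symm (fun m : Fin k => ((k - 1).choose m : ℝ)),
      Equiv.sum_comp σ.symm (fun m : Fin k => ((k - 1).choose m : ℝ))] at h1
    refine mul_right_cancel₀ (ne_of_gt ?_) h1
    refine Finset.sum_pos (fun m _ => ?_) ⟨⟨0, hk0⟩, Finset.mem_univ _⟩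
    exact_mod_cast Nat.choose_pos (by have := m.2; omega)
  have hchoose : ∀ j, (k - 1).choose (π.symm j) = (k - 1).choose (σ.symm j) := by
    intro j
    have h1 := habs j
    rw [← hab] at h1
    exact_mod_cast mul_left_cancel₀ (abs_ne_zero.2 ha) h1
  have hends : ∀ i : Fin k, (i : ℕ) = 0 ∨ (i : ℕ) = k - 1 →
      σ i = π ⟨0, hk0⟩ ∨ σ i = π ⟨k - 1, hk1⟩ := by
    intro i hi
    have h1 := hchoose (σ i)
    rw [Equiv.symm_apply_apply] at h1
    have h2 : (k - 1).choose i = 1 := by rcases hi with hi | hi <;> simp [hi]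
    rw [h2] at h1
    rcases eq_zero_or_eq_of_choose_eq_one h1 with h3 | h3
    · left
      rw [← Equiv.symm_apply_eq]
      exact Fin.ext h3
    · right
      rw [← Equiv.symm_apply_eq]
      exact Fin.ext h3
  have hsum : ∀ i, σ i = π i → a + b = 0 := by
    intro i hi
    have h1 := hu (σ i)
    rw [Equiv.symm_apply_apply, hi, Equiv.symm_apply_apply, ← add_mul] at h1
    exact (mul_eq_zero.1 h1).resolve_right (coeff_bern_top_ne_zero _)
  have h0 : ∀ u : ℝ, a * (bern (π ⟨0, hk0⟩)).eval u + b * (bern (σ ⟨0, hk0⟩)).eval u +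
      d * (bern (τ ⟨0, hl0⟩)).eval u = c := fun u => by
    rw [← permKernel_zero_left, ← permKernel_zero_left, ← permKernel_zero_left, h]
  have h1 : ∀ u : ℝ, a * (bern (π ⟨k - 1, hk1⟩)).eval u + b * (bern (σ ⟨k - 1, hk1⟩)).eval u +
      d * (bern (τ ⟨l - 1, hl1⟩)).eval u = c := fun u => by
    rw [← permKernel_one_left, ← permKernel_one_left, ← permKernel_one_left, h]
  by_cases hσ0 : σ ⟨0, hk0⟩ = π ⟨0, hk0⟩
  · refine hd (eq_zero_of_mul_bern_eval_const hl (τ ⟨0, hl0⟩) (c := c) fun u => ?_)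
    have h2 := h0 u
    rw [hσ0, ← add_mul, hsum _ hσ0] at h2
    linarith
  by_cases hσ1 : σ ⟨k - 1, hk1⟩ = π ⟨k - 1, hk1⟩
  · refine hd (eq_zero_of_mul_bern_eval_const hl (τ ⟨l - 1, hl1⟩) (c := c) fun u => ?_)
    have h2 := h1 u
    rw [hσ1, ← add_mul, hsum _ hσ1] at h2
    linarith
  have hσ0' := (hends ⟨0, hk0⟩ (Or.inl rfl)).resolve_left hσ0
  have hσ1' := (hends ⟨k - 1, hk1⟩ (Or.inr rfl)).resolve_right hσ1
  by_cases hlk' : l = k - 1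
  · have h2 : ∀ u : ℝ, d * a * (bern (τ ⟨0, hl0⟩)).eval u +
        -(d * b) * (bern (τ ⟨l - 1, hl1⟩)).eval u = (a - b) * c := by
      intro u
      have e0 := h0 u
      have e1 := h1 u
      have hsq : a ^ 2 = b ^ 2 := (sq_eq_sq_iff_abs_eq_abs a b).2 hab
      rw [hσ0'] at e0
      rw [hσ1'] at e1
      linear_combination a * e0 - b * e1 - (bern (π ⟨0, hk0⟩)).eval u * hsq
    have h3 := eq_of_sum_mul_bern_eval (k := l)
      (x := fun j => d * a * (if j = τ ⟨0, hl0⟩ then 1 else 0) +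
        -(d * b) * (if j = τ ⟨l - 1, hl1⟩ then 1 else 0))
      (y := fun _ => (a - b) * c) (fun u => by
        rw [← const_eq_sum_bern hl0, ← h2 u]
        simp [add_mul, mul_assoc, Finset.sum_add_distrib])
    obtain ⟨j, hj0, hj1⟩ := exists_fin_ne_ne (by omega) (τ ⟨0, hl0⟩) (τ ⟨l - 1, hl1⟩)
    have h4 := congrFun h3 j
    have h5 := congrFun h3 (τ ⟨0, hl0⟩)
    have hτ : τ ⟨0, hl0⟩ ≠ τ ⟨l - 1, hl1⟩ := by
      intro h6
      have := congrArg Fin.val (τ.injective h6)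
      simp only at this
      omega
    simp only [if_neg hj0, if_neg hj1, if_true, if_neg hτ, mul_zero, mul_one, add_zero] at h4 h5
    rw [← h4] at h5
    exact (mul_ne_zero hd ha) h5
  · -- The coefficient of degree `k - 2` vanishes for `m = k - 1` but not for `m = 0`.
    have h2 := coeff_relation h (e := k - 2) (by omega) (by omega) (σ ⟨k - 1, hk1⟩)
    rw [Equiv.symm_apply_apply, hσ1', Equiv.symm_apply_apply, coeff_bern, coeff_bern,
      if_pos (by simp), if_neg (by simp; omega), mul_zero, add_zero] at h2
    have h3 : (k - 1).choose (k - 2) ≠ 0 := (Nat.choose_pos (by omega)).ne'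
    simp [ha, h3] at h2

/-- At most three patterns of order at least two, not both patterns of order two among them and one
of order at least four, satisfy no relation, even together with one longer pattern `ρ`. -/
theorem eq_zero_of_sum_mul_permKernel_eq {S : Finset FinPerm} (hcard : S.card ≤ 3)
    (h2 : ∀ p ∈ S, 2 ≤ p.1) (h12 : ∀ p ∈ S, ∀ q ∈ S, p.1 = 2 → q.1 = 2 → p = q)
    (h4 : ∃ p ∈ S, 4 ≤ p.1) {ρ : FinPerm} (hρ : ∀ p ∈ S, p.1 < ρ.1) {γ : FinPerm → ℝ} {c : ℝ}
    (h : ∀ s u : ℝ, ∑ p ∈ insert ρ S, γ p * permKernel p s u = c) :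
    ∀ p ∈ insert ρ S, γ p = 0 := by
  by_contra hcon
  push Not at hcon
  set N := (insert ρ S).filter (fun p => γ p ≠ 0) with hN
  have hNne : N.Nonempty := by
    obtain ⟨p, hp, hp0⟩ := hcon
    exact ⟨p, Finset.mem_filter.2 ⟨hp, hp0⟩⟩
  have hNrel : ∀ s u : ℝ, ∑ p ∈ N, γ p * permKernel p s u = c := by
    intro s u
    rw [← h s u, hN, Finset.sum_filter]
    refine Finset.sum_congr rfl fun p _ => ?_
    split_ifs with h0
    · rfl
    · rw [not_not.1 h0, zero_mul]
  have hN0 : ∀ p ∈ N, γ p ≠ 0 := fun p hp => (Finset.mem_filter.1 hp).2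
  have hNS : ∀ p ∈ N, p = ρ ∨ p ∈ S := fun p hp =>
    Finset.mem_insert.1 (Finset.mem_filter.1 hp).1
  obtain ⟨p4, hp4, hp4'⟩ := h4
  have hN2 : ∀ p ∈ N, 2 ≤ p.1 := by
    intro p hp
    rcases hNS p hp with rfl | hpS
    · have := hρ p4 hp4
      omega
    · exact h2 p hpS
  obtain ⟨p1, hp1, hmax⟩ := Finset.exists_max_image N (fun p => p.1) hNne
  obtain ⟨p2, hp2, hne, heq⟩ : ∃ p2 ∈ N, p2 ≠ p1 ∧ p2.1 = p1.1 := by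
    by_contra hno
    push Not at hno
    exact hN0 p1 hp1 (coeff_eq_zero_of_order_lt hNrel hp1 (hN2 p1 hp1) fun q hq hqne =>
      lt_of_le_of_ne (hmax q hq) (hno q hq hqne))
  have hρN : ρ ∉ N := by
    intro hmem
    have hle := hmax ρ hmem
    have h1 : p1 = ρ := (hNS p1 hp1).resolve_right fun hs => by
      have := hρ p1 hs
      omega
    rcases hNS p2 hp2 with h3 | h3
    · exact hne (h3.trans h1.symm)
    · have := hρ p2 h3
      rw [heq, h1] at this
      omega
  have hsub : N ⊆ S := fun p hp => (hNS p hp).resolve_left fun h0 => hρN (h0 ▸ hp)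
  obtain ⟨k, π⟩ := p1
  obtain ⟨k', σ⟩ := p2
  simp only at heq
  subst heq
  have hne' : π ≠ σ := fun h0 => hne (by rw [h0])
  have hk2 := hN2 _ hp1
  simp only at hk2
  by_cases hthird : ∃ p3 ∈ N, p3 ≠ ⟨k', π⟩ ∧ p3 ≠ ⟨k', σ⟩
  · obtain ⟨p3, hp3, h31, h32⟩ := hthird
    have hsub3 : ({⟨k', π⟩, ⟨k', σ⟩, p3} : Finset FinPerm) ⊆ N := by
      intro q hq
      simp only [Finset.mem_insert, Finset.mem_singleton] at hq
      rcases hq with rfl | rfl | rfl <;> assumption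
    have hc3 : ({⟨k', π⟩, ⟨k', σ⟩, p3} : Finset FinPerm).card = 3 :=
      Finset.card_eq_three.2 ⟨_, _, _, hne.symm, h31.symm, h32.symm, rfl⟩
    have hN3 : ({⟨k', π⟩, ⟨k', σ⟩, p3} : Finset FinPerm) = S :=
      Finset.eq_of_subset_of_card_le (hsub3.trans hsub) (by omega)
    have hNeq : N = {⟨k', π⟩, ⟨k', σ⟩, p3} :=
      Finset.Subset.antisymm (hN3 ▸ hsub) hsub3
    have hk4 : 4 ≤ k' := hp4'.trans (hmax p4 (by rw [hNeq, hN3]; exact hp4))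
    obtain ⟨l, τ⟩ := p3
    have hrel : ∀ s u : ℝ, γ ⟨k', π⟩ * permKernel ⟨k', π⟩ s u +
        γ ⟨k', σ⟩ * permKernel ⟨k', σ⟩ s u + γ ⟨l, τ⟩ * permKernel ⟨l, τ⟩ s u = c := by
      intro s u
      rw [← hNrel s u, hNeq, Finset.sum_insert (by simp [hne.symm, h31.symm]),
        Finset.sum_insert (by simp [h32.symm]), Finset.sum_singleton, add_assoc]
    rcases (hmax _ hp3).lt_or_eq with hlt | heq'
    · exact no_relation_shorter hrel hk4 (hN2 _ hp3) hlt (hN0 _ hp1) (hN0 _ hp3)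
    · simp only at heq'
      subst heq'
      exact no_relation_same_order hrel (Or.inl hk4) hne' (hN0 _ hp1) (hN0 _ hp2)
  · push Not at hthird
    have hNeq : N = {⟨k', π⟩, ⟨k', σ⟩} := by
      ext q
      simp only [Finset.mem_insert, Finset.mem_singleton]
      constructor
      · intro hq
        by_cases h0 : q = ⟨k', π⟩
        · exact Or.inl h0
        · exact Or.inr (hthird q hq h0)
      · rintro (rfl | rfl) <;> assumption
    have hrel : ∀ s u : ℝ, γ ⟨k', π⟩ * permKernel ⟨k', π⟩ s u +
        γ ⟨k', σ⟩ * permKernel ⟨k', σ⟩ s u + 0 * permKernel ⟨k', π⟩ s u = c := by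
      intro s u
      rw [← hNrel s u, hNeq, Finset.sum_insert (by simp [hne.symm]), Finset.sum_singleton,
        zero_mul, add_zero]
    rcases hk2.lt_or_eq with hk3 | hk3
    · exact no_relation_same_order hrel (Or.inr ⟨hk3, rfl⟩) hne' (hN0 _ hp1) (hN0 _ hp2)
    · exact hne (h12 _ (hsub hp2) _ (hsub hp1) hk3.symm hk3.symm)

end BernsteinRelations

/-! ### Patterns of order at least four -/

theorem integrable_eval_of_mem_balanced {h : ℝ × ℝ → ℝ} (hh : h ∈ balanced) {k : ℕ} (m : Fin k)
    (ν : Measure (Fin k → ℝ × ℝ)) [IsFiniteMeasure ν] : Integrable (fun z => h (z m)) ν := by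
  obtain ⟨hm, ⟨C, hC⟩, -⟩ := hh
  have hm' : Measurable fun z : Fin k → ℝ × ℝ => h (z m) := hm.comp (measurable_pi_apply m)
  exact Integrable.of_bound hm'.aestronglyMeasurable C (ae_of_all _ fun z => hC (z m))

theorem firstVariation_add {k : ℕ} (p : Equiv.Perm (Fin k)) {g h : ℝ × ℝ → ℝ}
    (hg : g ∈ balanced) (hh : h ∈ balanced) :
    firstVariation p (g + h) = firstVariation p g + firstVariation p h := by
  simp only [firstVariation, Pi.add_apply, ← Finset.sum_add_distrib]
  exact Finset.sum_congr rfl fun m _ => integral_add (integrable_eval_of_mem_balanced hg m _)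
    (integrable_eval_of_mem_balanced hh m _)

theorem firstVariation_smul {k : ℕ} (p : Equiv.Perm (Fin k)) (c : ℝ) (h : ℝ × ℝ → ℝ) :
    firstVariation p (c • h) = c * firstVariation p h := by
  simp only [firstVariation, Pi.smul_apply, smul_eq_mul, Finset.mul_sum, integral_const_mul]

/-- If the first variations of the patterns `p i` satisfy no linear relation on products of step
functions, then they take arbitrary values on the perturbations. -/
theorem firstVariation_surjective {ι : Type*} [Fintype ι] (p : ι → FinPerm)
    (hind : ∀ β : ι → ℝ, (∀ s ∈ Set.Icc (0 : ℝ) 1, ∀ u ∈ Set.Icc (0 : ℝ) 1,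
      ∑ i, β i * firstVariation (p i).2 (fun z => stepFun s z.1 * stepFun u z.2) = 0) → β = 0)
    (w : ι → ℝ) : ∃ h ∈ balanced, ∀ i, firstVariation (p i).2 h = w i := by
  classical
  let L : balanced →ₗ[ℝ] (ι → ℝ) :=
    { toFun := fun h i => firstVariation (p i).2 h
      map_add' := fun g h => funext fun i => firstVariation_add _ g.2 h.2
      map_smul' := fun c h => funext fun i => firstVariation_smul _ c _ }
  have hrange : LinearMap.range L = ⊤ := by
    by_contra hne
    obtain ⟨f, hf, hle⟩ := Submodule.exists_le_ker_of_lt_top _ (lt_top_iff_ne_top.2 hne)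
    have hfsum : ∀ v : ι → ℝ, f v = ∑ i, f (Pi.single i 1) * v i := fun v => by
      rw [LinearMap.pi_apply_eq_sum_univ f v]
      refine Finset.sum_congr rfl fun i _ => ?_
      rw [smul_eq_mul, mul_comm]
      congr 2
      funext j
      simp [Pi.single_apply, eq_comm]
    have hβ := hind (fun i => f (Pi.single i 1)) fun s hs u hu => by
      have h1 := hle (LinearMap.mem_range_self L ⟨_, stepFun_mul_mem_balanced hs hu⟩)
      rw [LinearMap.mem_ker, hfsum] at h1
      exact h1
    apply hf
    ext i
    simpa using congrFun hβ i
  obtain ⟨h, hh⟩ := LinearMap.range_eq_top.1 hrange w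
  exact ⟨h, h.2, fun i => congrFun hh i⟩

theorem integral_pi_prod_one_add {h : ℝ × ℝ → ℝ} (hh : h ∈ balanced) (k : ℕ) :
    ∫ z : Fin k → ℝ × ℝ, ∏ i, (1 + h (z i)) ∂(Measure.pi fun _ => squareMeasure) = 1 := by
  rw [integral_fintype_prod_eq_prod (fun _ z => 1 + h z)]
  have hint : Integrable h squareMeasure := by
    obtain ⟨hm, ⟨C, hC⟩, -⟩ := hh
    exact Integrable.of_bound hm.aestronglyMeasurable C (ae_of_all _ hC)
  rw [integral_add (integrable_const _) hint, hh.2.2]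
  simp

open Classical in
theorem sum_indicator_isPattern {k : ℕ} {z : Fin k → ℝ × ℝ}
    (hx : Function.Injective fun i => (z i).1) (hy : Function.Injective fun i => (z i).2) :
    ∑ p : Equiv.Perm (Fin k), ∑ σ : Equiv.Perm (Fin k),
      (if IsPattern p (z ∘ σ) then (1 : ℝ) else 0) = 1 := by
  rw [Finset.sum_comm]
  have h1 : ∀ p σ : Equiv.Perm (Fin k), (if IsPattern p (z ∘ σ) then (1 : ℝ) else 0) =
      (sortedTuples k).indicator (fun _ => (1 : ℝ)) ((fun i => (z i).1) ∘ σ) *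
        (sortedTuples k).indicator (fun _ => (1 : ℝ)) (((fun i => (z i).2) ∘ σ) ∘ ⇑p⁻¹) := by
    intro p σ
    rw [Set.indicator_apply, Set.indicator_apply, ite_zero_mul_ite_zero, mul_one]
    exact if_congr Iff.rfl rfl rfl
  simp only [h1, ← Finset.mul_sum]
  have h2 : ∀ σ : Equiv.Perm (Fin k), ∑ p : Equiv.Perm (Fin k),
      (sortedTuples k).indicator (fun _ => (1 : ℝ)) (((fun i => (z i).2) ∘ σ) ∘ ⇑p⁻¹) = 1 := by
    intro σ
    refine Eq.trans ?_ (sum_indicator_sortedTuples (hy.comp σ.injective))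
    exact Equiv.sum_comp (Equiv.inv (Equiv.Perm (Fin k))) fun q : Equiv.Perm (Fin k) =>
      (sortedTuples k).indicator (fun _ => (1 : ℝ)) (((fun i => (z i).2) ∘ σ) ∘ ⇑q)
  simp only [h2, mul_one]
  exact sum_indicator_sortedTuples hx

/-- Every sample forms exactly one pattern of each order. -/
theorem sum_patternIntegral {h : ℝ × ℝ → ℝ} (hh : h ∈ balanced) (k : ℕ) :
    ∑ p : Equiv.Perm (Fin k), patternIntegral p (fun z => 1 + h z) = 1 / (k.factorial : ℝ) := by
  classical
  let Φ : (Fin k → ℝ × ℝ) → ℝ := fun z => ∏ i, (1 + h (z i))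
  let ν : Measure (Fin k → ℝ × ℝ) := Measure.pi fun _ => squareMeasure
  have hΦ : Integrable Φ ν := integrable_prod (fun _ => measurable_const.add hh.1)
    (fun _ => exists_bound_one_add hh) _
  have hmp : ∀ σ : Equiv.Perm (Fin k), MeasurePreserving (reindex (ℝ × ℝ) σ) ν ν :=
    fun σ => measurePreserving_reindex squareMeasure σ
  have hsymm : ∀ (σ : Equiv.Perm (Fin k)) z, Φ (reindex (ℝ × ℝ) σ z) = Φ z := fun σ z =>
    Equiv.prod_comp σ fun i => 1 + h (z i)
  have hi : ∀ p σ : Equiv.Perm (Fin k), Integrable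
      (fun z => {z | IsPattern p z}.indicator Φ (reindex (ℝ × ℝ) σ z)) ν := fun p σ =>
    (hmp σ).integrable_comp_of_integrable (hΦ.indicator (measurableSet_isPattern p))
  have h1 : ∫ z, Φ z ∂ν = ∫ z, ∑ p : Equiv.Perm (Fin k), ∑ σ : Equiv.Perm (Fin k),
      {z | IsPattern p z}.indicator Φ (reindex (ℝ × ℝ) σ z) ∂ν := by
    refine integral_congr_ae ?_
    filter_upwards [ae_injective squareMeasure measurable_fst squareMeasure_fst_eq (ι := Fin k),
      ae_injective squareMeasure measurable_snd squareMeasure_snd_eq (ι := Fin k)] with z hx hy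
    rw [← mul_one (Φ z), ← sum_indicator_isPattern hx hy, Finset.mul_sum]
    refine Finset.sum_congr rfl fun p _ => ?_
    rw [Finset.mul_sum]
    refine Finset.sum_congr rfl fun σ _ => ?_
    rw [Set.indicator_apply, hsymm, mul_ite, mul_one, mul_zero]
    rfl
  have h2 : ∫ z, Φ z ∂ν = 1 := integral_pi_prod_one_add hh k
  rw [h2, integral_finsetSum _ fun p _ => integrable_finsetSum _ fun σ _ => hi p σ] at h1
  have h3 : ∀ p : Equiv.Perm (Fin k), ∫ z, ∑ σ : Equiv.Perm (Fin k),
      {z | IsPattern p z}.indicator Φ (reindex (ℝ × ℝ) σ z) ∂ν =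
      k.factorial * patternIntegral p (fun z => 1 + h z) := by
    intro p
    rw [integral_finsetSum _ fun σ _ => hi p σ,
      Finset.sum_congr rfl fun σ _ => (hmp σ).integral_comp' ({z | IsPattern p z}.indicator Φ),
      integral_indicator (measurableSet_isPattern p)]
    simp [Finset.card_univ, Fintype.card_perm, patternIntegral, Φ, ν]
  simp only [h3, ← Finset.mul_sum] at h1
  have h4 : (0 : ℝ) < k.factorial := by exact_mod_cast k.factorial_pos
  rw [eq_div_iff h4.ne', mul_comm]
  exact h1.symm

theorem patternIntegral_of_order_le_one {h : ℝ × ℝ → ℝ} (hh : h ∈ balanced) {p : FinPerm}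
    (hp : p.1 ≤ 1) : patternIntegral p.2 (fun z => 1 + h z) = (1 / (p.1.factorial : ℝ)) ^ 2 := by
  obtain ⟨k, p⟩ := p
  have h1 := sum_patternIntegral hh k
  have : Subsingleton (Equiv.Perm (Fin k)) := by
    have : Subsingleton (Fin k) := Fin.subsingleton_iff_le_one.2 hp
    infer_instance
  rw [Fintype.sum_subsingleton _ p] at h1
  rw [h1, Nat.factorial_eq_one.2 hp]
  simp

theorem patternIntegral_one_add_swap {h : ℝ × ℝ → ℝ} (hh : h ∈ balanced) :
    patternIntegral (1 : Equiv.Perm (Fin 2)) (fun z => 1 + h z) +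
      patternIntegral (Equiv.swap (0 : Fin 2) 1) (fun z => 1 + h z) = 1 / 2 := by
  have h1 := sum_patternIntegral hh 2
  have h2 : (Finset.univ : Finset (Equiv.Perm (Fin 2))) = {1, Equiv.swap 0 1} := by decide
  rw [h2, Finset.sum_pair (by decide)] at h1
  simpa using h1

/-- Sets of at most three patterns, one of which has order at least four, are not forcing. -/
theorem not_forcing_of_four_le_order {S : Finset FinPerm} (hcard : S.card ≤ 3)
    (h4 : ∃ p ∈ S, 4 ≤ p.1) : ¬ FinPerm.Forcing (S : Set FinPerm) := by
  classical
  -- Patterns of order at most one carry no information, and the density of `21` is determined by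
  -- that of `12`; the remaining patterns are independent.
  set q12 : FinPerm := ⟨2, 1⟩ with hq12
  set q21 : FinPerm := ⟨2, Equiv.swap 0 1⟩ with hq21
  set S' := S.filter (fun p => 2 ≤ p.1 ∧ ¬ (p = q21 ∧ q12 ∈ S)) with hS'
  have hsub : S' ⊆ S := Finset.filter_subset _ _
  set ρ : FinPerm := ⟨∑ p ∈ S, p.1 + 1, 1⟩ with hρ
  have hρlt : ∀ p ∈ S', p.1 < ρ.1 := by
    intro p hp
    have := Finset.single_le_sum (f := fun p : FinPerm => p.1) (fun _ _ => Nat.zero_le _) (hsub hp)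
    exact Nat.lt_succ_of_le this
  have hρS' : ρ ∉ S' := fun h => lt_irrefl _ (hρlt ρ h)
  have hperm2 : ∀ p : FinPerm, p.1 = 2 → p = q12 ∨ p = q21 := by
    rintro ⟨k, p⟩ hk
    simp only at hk
    subst hk
    have : ∀ p : Equiv.Perm (Fin 2), p = 1 ∨ p = Equiv.swap 0 1 := by decide
    rcases this p with rfl | rfl
    · exact Or.inl rfl
    · exact Or.inr rfl
  have h12 : ∀ p ∈ S', ∀ q ∈ S', p.1 = 2 → q.1 = 2 → p = q := by
    intro p hp q hq hp2 hq2
    have hp' := (Finset.mem_filter.1 hp).2.2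
    have hq' := (Finset.mem_filter.1 hq).2.2
    rcases hperm2 p hp2 with h1 | h1 <;> rcases hperm2 q hq2 with h2 | h2
    · rw [h1, h2]
    · exact absurd ⟨h2, h1 ▸ hsub hp⟩ hq'
    · exact absurd ⟨h1, h2 ▸ hsub hq⟩ hp'
    · rw [h1, h2]
  have h4' : ∃ p ∈ S', 4 ≤ p.1 := by
    obtain ⟨p, hp, hp4⟩ := h4
    refine ⟨p, Finset.mem_filter.2 ⟨hp, by omega, ?_⟩, hp4⟩
    rintro ⟨rfl, -⟩
    simp [hq21] at hp4
  set T := insert ρ S' with hT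
  have hT0 : ∀ p ∈ T, p.1 ≠ 0 := by
    intro p hp
    rcases Finset.mem_insert.1 hp with rfl | hp
    · exact Nat.succ_ne_zero _
    · have := (Finset.mem_filter.1 hp).2.1
      omega
  have hind : ∀ β : T → ℝ, (∀ s ∈ Set.Icc (0 : ℝ) 1, ∀ u ∈ Set.Icc (0 : ℝ) 1,
      ∑ i, β i * firstVariation (i : FinPerm).2 (fun z => stepFun s z.1 * stepFun u z.2) = 0) →
      β = 0 := by
    intro β hβ
    let β' : FinPerm → ℝ := fun p => if hp : p ∈ T then β ⟨p, hp⟩ else 0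
    have hβ' : ∀ i : T, β i = β' i := fun i => by simp [β']
    obtain ⟨c, hc⟩ := sum_mul_permKernel_eq T id β' (by
      intro s hs u hu
      rw [← hβ s hs u hu, ← Finset.sum_coe_sort T]
      exact Finset.sum_congr rfl fun i _ => by rw [hβ']; rfl)
    have h0 := eq_zero_of_sum_mul_permKernel_eq ((Finset.card_le_card hsub).trans hcard)
      (fun p hp => (Finset.mem_filter.1 hp).2.1) h12 h4' hρlt hc
    funext i
    have h1 := h0 i i.2
    have h2 : (((i : FinPerm).1 : ℝ) / ((i : FinPerm).1.factorial : ℝ)) ^ 2 ≠ 0 := by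
      have := hT0 i i.2
      have h3 : (i : FinPerm).1.factorial ≠ 0 := Nat.factorial_ne_zero _
      positivity
    rw [hβ']
    exact (mul_eq_zero.1 h1).resolve_right h2
  obtain ⟨h, hh, hpos, η, hη, hval⟩ := exists_perturbation balanced le_rfl
    (fun i : T => (i : FinPerm)) (firstVariation_surjective _ hind)
    (fun i => if (i : FinPerm) = ρ then 1 else 0)
  have hvalS' : ∀ p ∈ S', patternIntegral p.2 (fun z => 1 + h z) =
      (1 / (p.1.factorial : ℝ)) ^ 2 := by
    intro p hp
    have h1 := hval ⟨p, Finset.mem_insert_of_mem hp⟩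
    have h2 : p ≠ ρ := fun h0 => hρS' (h0 ▸ hp)
    simp only [if_neg h2, mul_zero, add_zero, patternIntegral_one] at h1
    exact h1
  refine not_forcing_of_density hh hpos S (fun p hp => ?_) ρ ?_
  · rcases Nat.lt_or_ge p.1 2 with hp2 | hp2
    · exact patternIntegral_of_order_le_one hh (by omega)
    by_cases hex : p = q21 ∧ q12 ∈ S
    · obtain ⟨rfl, hmem⟩ := hex
      have h1 := hvalS' q12 (Finset.mem_filter.2 ⟨hmem, le_rfl, fun h0 => by
        have h2 := h0.1
        simp only [hq12, hq21, Sigma.mk.injEq, heq_eq_eq, true_and] at h2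
        exact absurd h2 (by decide)⟩)
      have h2 := patternIntegral_one_add_swap hh
      change patternIntegral (1 : Equiv.Perm (Fin 2)) _ =
        (1 / ((Nat.factorial 2 : ℕ) : ℝ)) ^ 2 at h1
      change patternIntegral (Equiv.swap (0 : Fin 2) 1) _ = (1 / ((Nat.factorial 2 : ℕ) : ℝ)) ^ 2
      rw [h1] at h2
      norm_num at h2 ⊢
      linarith
    · exact hvalS' p (Finset.mem_filter.2 ⟨hp, hp2, hex⟩)
  · have h1 := hval ⟨ρ, Finset.mem_insert_self _ _⟩
    simp only [if_true, mul_one, patternIntegral_one] at h1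
    rw [h1]
    simpa using hη

/-! ### Patterns of order at most three -/

/-- The reflection of the unit interval. -/
def unitReflection : ℝ ≃ᵐ ℝ where
  toFun x := 1 - x
  invFun x := 1 - x
  left_inv x := by simp
  right_inv x := by simp
  measurable_toFun := by
    change Measurable fun x : ℝ => 1 - x
    fun_prop
  measurable_invFun := by
    change Measurable fun x : ℝ => 1 - x
    fun_prop

theorem measurePreserving_unitReflection :
    MeasurePreserving unitReflection unitMeasure unitMeasure := by
  have h1 : MeasurePreserving unitReflection volume volume :=
    Measure.measurePreserving_sub_left volume 1
  have h2 := h1.restrict_preimage_emb unitReflection.measurableEmbedding (Set.Icc 0 1)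
  have h3 : unitReflection ⁻¹' Set.Icc 0 1 = Set.Icc (0 : ℝ) 1 := by
    ext x
    change 0 ≤ 1 - x ∧ 1 - x ≤ 1 ↔ 0 ≤ x ∧ x ≤ 1
    constructor <;> rintro ⟨h, h'⟩ <;> constructor <;> linarith
  rw [h3] at h2
  exact h2

/-- Applying a map of the square to each point of a tuple, after reindexing. -/
theorem patternIntegral_eq_of_preimage {k : ℕ} {p q : Equiv.Perm (Fin k)} {f : ℝ × ℝ → ℝ}
    (e : ℝ × ℝ ≃ᵐ ℝ × ℝ) (he : MeasurePreserving e squareMeasure squareMeasure)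
    (hf : ∀ z, f (e z) = f z) (σ : Equiv.Perm (Fin k))
    (h : ∀ z : Fin k → ℝ × ℝ, IsPattern p (fun i => e (z (σ i))) ↔ IsPattern q z) :
    patternIntegral p f = patternIntegral q f := by
  have h1 := (measurePreserving_reindex squareMeasure σ).setIntegral_preimage_emb
    (MeasurableEquiv.measurableEmbedding _) (fun z => ∏ i, f (z i))
    {z | IsPattern p fun i => e (z i)}
  have h2 := (measurePreserving_pi (fun _ : Fin k => squareMeasure) (fun _ => squareMeasure)
    fun _ => he).setIntegral_preimage_emb
    (MeasurableEquiv.piCongrRight fun _ : Fin k => e).measurableEmbedding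
    (fun z => ∏ i, f (z i)) {z | IsPattern p z}
  simp only [hf] at h2
  have h3 : reindex (ℝ × ℝ) σ ⁻¹' {z | IsPattern p fun i => e (z i)} = {z | IsPattern q z} :=
    Set.ext fun z => h z
  have h4 : ∀ z : Fin k → ℝ × ℝ, ∏ i, f (reindex (ℝ × ℝ) σ z i) = ∏ i, f (z i) := fun z =>
    Equiv.prod_comp σ fun i => f (z i)
  simp only [h4] at h1
  rw [h3] at h1
  unfold patternIntegral
  rw [← h2, h1]
  rfl

theorem strictMono_rev_iff {k : ℕ} {x : Fin k → ℝ} :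
    StrictMono (fun i : Fin k => 1 - x i.rev) ↔ StrictMono x := by
  constructor
  · intro h i j hij
    have := h (Fin.rev_lt_rev.2 hij)
    simp only [Fin.rev_rev] at this
    linarith
  · intro h i j hij
    have := h (Fin.rev_lt_rev.2 hij)
    simp only
    linarith

theorem patternIntegral_mul_rev {k : ℕ} (p : Equiv.Perm (Fin k)) {f : ℝ × ℝ → ℝ}
    (hf : ∀ x y, f (1 - x, y) = f (x, y)) :
    patternIntegral (p * Fin.revPerm) f = patternIntegral p f := by
  symm
  refine patternIntegral_eq_of_preimage (unitReflection.prodCongr (MeasurableEquiv.refl ℝ))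
    (measurePreserving_unitReflection.prod (MeasurePreserving.id _)) (fun z => hf z.1 z.2)
    Fin.revPerm fun z => ?_
  exact and_congr (strictMono_rev_iff (x := fun i => (z i).1)) Iff.rfl

theorem patternIntegral_inv {k : ℕ} (p : Equiv.Perm (Fin k)) {f : ℝ × ℝ → ℝ}
    (hf : ∀ x y, f (y, x) = f (x, y)) : patternIntegral p⁻¹ f = patternIntegral p f := by
  refine patternIntegral_eq_of_preimage MeasurableEquiv.prodComm
    Measure.measurePreserving_swap (fun z => hf z.1 z.2) p.symm fun z => ?_
  have h : (fun i => (z (p.symm (p i))).1) = fun i => (z i).1 := by simp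
  change StrictMono (fun i => (z (p.symm i)).2) ∧ StrictMono (fun i => (z (p.symm (p i))).1) ↔
    StrictMono (fun i => (z i).1) ∧ StrictMono (fun i => (z (p.symm i)).2)
  rw [h]
  exact and_comm

/-- The perturbations invariant under all symmetries of the square. -/
def symmetricPerturbations : Submodule ℝ (ℝ × ℝ → ℝ) where
  carrier := {h | h ∈ balanced ∧ (∀ x y, h (1 - x, y) = h (x, y)) ∧ ∀ x y, h (y, x) = h (x, y)}
  zero_mem' := ⟨balanced.zero_mem, fun _ _ => rfl, fun _ _ => rfl⟩
  add_mem' := by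
    rintro a b ⟨ha, ha1, ha2⟩ ⟨hb, hb1, hb2⟩
    exact ⟨balanced.add_mem ha hb, fun x y => by simp [ha1, hb1], fun x y => by
      rw [Pi.add_apply, Pi.add_apply, ha2, hb2]⟩
  smul_mem' := by
    rintro c a ⟨ha, ha1, ha2⟩
    exact ⟨balanced.smul_mem c ha, fun x y => by simp [ha1], fun x y => by
      rw [Pi.smul_apply, Pi.smul_apply, ha2]⟩

/-- The symmetrization of a centred step function under reflection. -/
noncomputable def evenStep (s x : ℝ) : ℝ := stepFun s x + stepFun s (1 - x)

theorem evenStep_reflect (s x : ℝ) : evenStep s (1 - x) = evenStep s x := by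
  simp [evenStep, add_comm]

theorem integrable_stepFun {s : ℝ} (hs : s ∈ Set.Icc (0 : ℝ) 1) :
    Integrable (stepFun s) unitMeasure :=
  Integrable.of_bound (measurable_stepFun s).aestronglyMeasurable 1
    (ae_of_all _ (abs_stepFun_le hs))

theorem integral_evenStep {s : ℝ} (hs : s ∈ Set.Icc (0 : ℝ) 1) :
    ∫ x, evenStep s x ∂unitMeasure = 0 := by
  have h1 : ∫ x, stepFun s (1 - x) ∂unitMeasure = 0 := by
    rw [← integral_stepFun hs]
    exact measurePreserving_unitReflection.integral_comp' (stepFun s)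
  have h2 : Integrable (fun x => stepFun s (1 - x)) unitMeasure :=
    measurePreserving_unitReflection.integrable_comp_of_integrable (integrable_stepFun hs)
  unfold evenStep
  rw [integral_add (integrable_stepFun hs) h2, h1, integral_stepFun hs, add_zero]

theorem evenStep_mul_mem {s : ℝ} (hs : s ∈ Set.Icc (0 : ℝ) 1) :
    (fun z : ℝ × ℝ => evenStep s z.1 * evenStep s z.2) ∈ symmetricPerturbations := by
  have hm : Measurable (evenStep s) := (measurable_stepFun s).add
    ((measurable_stepFun s).comp (measurable_const.sub measurable_id))
  have hb : ∀ x, |evenStep s x| ≤ 2 := fun x => (abs_add_le _ _).trans (by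
    linarith [abs_stepFun_le hs x, abs_stepFun_le hs (1 - x)])
  refine ⟨⟨(hm.comp measurable_fst).mul (hm.comp measurable_snd), ⟨2 * 2, fun z => ?_⟩, ?_⟩,
    fun x y => ?_, fun x y => ?_⟩
  · rw [abs_mul]
    exact mul_le_mul (hb _) (hb _) (abs_nonneg _) (by norm_num)
  · rw [squareMeasure, integral_prod_mul, integral_evenStep hs, zero_mul]
  · simp only [evenStep_reflect]
  · simp only [mul_comm]

theorem setIntegral_stepFun_reflect {k : ℕ} {s : ℝ} (hs : s ∈ Set.Icc (0 : ℝ) 1) (m : Fin k) :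
    ∫ x in sortedTuples k, stepFun s (1 - x m) ∂(cubeMeasure k) =
      (1 / (k.factorial : ℝ)) * ((orderStatCDF k m.rev).eval s - s) := by
  rw [← setIntegral_stepFun hs]
  have h1 := (measurePreserving_reindex unitMeasure Fin.revPerm).setIntegral_preimage_emb
    (MeasurableEquiv.measurableEmbedding _) (fun x : Fin k → ℝ => stepFun s (1 - x m.rev))
    {x | StrictMono fun i => 1 - x i}
  have h2 := (measurePreserving_pi (fun _ : Fin k => unitMeasure) (fun _ => unitMeasure)
    fun _ => measurePreserving_unitReflection).setIntegral_preimage_emb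
    (MeasurableEquiv.piCongrRight fun _ : Fin k => unitReflection).measurableEmbedding
    (fun x => stepFun s (x m.rev)) (sortedTuples k)
  have h3 : reindex ℝ Fin.revPerm ⁻¹' {x : Fin k → ℝ | StrictMono fun i => 1 - x i} =
      sortedTuples k := Set.ext fun x => strictMono_rev_iff
  rw [h3] at h1
  have h4 : ∀ x : Fin k → ℝ, reindex ℝ Fin.revPerm x m.rev = x m := fun x => by
    change x (m.rev.rev) = x m
    rw [Fin.rev_rev]
  simp only [h4] at h1
  exact h1.trans h2

/-- The mean of `evenStep s` at the `m`-th smallest of `k` uniform points. -/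
noncomputable def evenMean (k : ℕ) (m : Fin k) (s : ℝ) : ℝ :=
  (orderStatCDF k m).eval s + (orderStatCDF k m.rev).eval s - 2 * s

theorem setIntegral_evenStep {k : ℕ} {s : ℝ} (hs : s ∈ Set.Icc (0 : ℝ) 1) (m : Fin k) :
    ∫ x in sortedTuples k, evenStep s (x m) ∂(cubeMeasure k) =
      (1 / (k.factorial : ℝ)) * evenMean k m s := by
  have h1 : ∀ g : ℝ → ℝ, Measurable g → (∀ x, |g x| ≤ 1) →
      IntegrableOn (fun x : Fin k → ℝ => g (x m)) (sortedTuples k) (cubeMeasure k) := by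
    intro g hg hb
    have hm : Measurable fun x : Fin k → ℝ => g (x m) := hg.comp (measurable_pi_apply m)
    exact Integrable.of_bound hm.aestronglyMeasurable 1 (ae_of_all _ fun x => hb _)
  unfold evenStep
  rw [integral_add (h1 _ (measurable_stepFun s) (abs_stepFun_le hs))
    (h1 (fun x => stepFun s (1 - x))
      ((measurable_stepFun s).comp (measurable_const.sub measurable_id))
      fun x => abs_stepFun_le hs _),
    setIntegral_stepFun hs, setIntegral_stepFun_reflect hs, evenMean]
  ring

theorem firstVariation_one_evenStep {k : ℕ} {s : ℝ} (hs : s ∈ Set.Icc (0 : ℝ) 1) :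
    firstVariation (1 : Equiv.Perm (Fin k)) (fun z => evenStep s z.1 * evenStep s z.2) =
      (1 / (k.factorial : ℝ)) ^ 2 * ∑ m : Fin k, evenMean k m s ^ 2 := by
  rw [firstVariation, Finset.mul_sum]
  refine Finset.sum_congr rfl fun m _ => ?_
  have h := setIntegral_isPattern (1 : Equiv.Perm (Fin k)) (fun x => evenStep s (x m))
    (fun y => evenStep s (y m))
  rw [setIntegral_evenStep hs] at h
  refine h.trans ?_
  ring

theorem firstVariation_one_three_quarter :
    firstVariation (1 : Equiv.Perm (Fin 3)) (fun z => evenStep (1 / 4) z.1 * evenStep (1 / 4) z.2) =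
      (1 / 6) ^ 2 * (27 / 512) := by
  rw [firstVariation_one_evenStep (by norm_num)]
  norm_num [Fin.sum_univ_succ, evenMean, orderStatCDF, Finset.sum_filter, Finset.sum_range_succ,
    bernsteinPolynomial, Nat.choose, Nat.factorial, Fin.rev]

theorem firstVariation_one_three_third :
    firstVariation (1 : Equiv.Perm (Fin 3)) (fun z => evenStep (1 / 3) z.1 * evenStep (1 / 3) z.2) =
      (1 / 6) ^ 2 * (8 / 243) := by
  rw [firstVariation_one_evenStep (by norm_num)]
  norm_num [Fin.sum_univ_succ, evenMean, orderStatCDF, Finset.sum_filter, Finset.sum_range_succ,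
    bernsteinPolynomial, Nat.choose, Nat.factorial, Fin.rev]

theorem firstVariation_one_five_quarter :
    firstVariation (1 : Equiv.Perm (Fin 5)) (fun z => evenStep (1 / 4) z.1 * evenStep (1 / 4) z.2) =
      (1 / 120) ^ 2 * (33075 / 131072) := by
  rw [firstVariation_one_evenStep (by norm_num)]
  norm_num [Fin.sum_univ_succ, evenMean, orderStatCDF, Finset.sum_filter, Finset.sum_range_succ,
    bernsteinPolynomial, Nat.choose, Nat.factorial, Fin.rev]

theorem firstVariation_one_five_third :
    firstVariation (1 : Equiv.Perm (Fin 5)) (fun z => evenStep (1 / 3) z.1 * evenStep (1 / 3) z.2) =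
      (1 / 120) ^ 2 * (9400 / 59049) := by
  rw [firstVariation_one_evenStep (by norm_num)]
  norm_num [Fin.sum_univ_succ, evenMean, orderStatCDF, Finset.sum_filter, Finset.sum_range_succ,
    bernsteinPolynomial, Nat.choose, Nat.factorial, Fin.rev]

theorem exists_solution_of_det_ne_zero {A B C D : ℝ} (hdet : A * D - B * C ≠ 0) (v w : ℝ) :
    ∃ a b : ℝ, a * A + b * B = v ∧ a * C + b * D = w := by
  refine ⟨(v * D - w * B) / (A * D - B * C), (w * A - v * C) / (A * D - B * C), ?_, ?_⟩ <;>
  · rw [div_mul_eq_mul_div, div_mul_eq_mul_div, ← add_div, div_eq_iff hdet]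
    ring

/-- Symmetric perturbations move the probabilities of `123` and `12345` independently. -/
theorem firstVariation_surjective_symmetric (w : Fin 2 → ℝ) :
    ∃ h ∈ symmetricPerturbations, ∀ i, firstVariation
      ((![⟨3, 1⟩, ⟨5, 1⟩] : Fin 2 → FinPerm) i).2 h = w i := by
  have hq : (1 / 4 : ℝ) ∈ Set.Icc (0 : ℝ) 1 := by norm_num
  have ht : (1 / 3 : ℝ) ∈ Set.Icc (0 : ℝ) 1 := by norm_num
  set g : ℝ × ℝ → ℝ := fun z => evenStep (1 / 4) z.1 * evenStep (1 / 4) z.2 with hg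
  set g' : ℝ × ℝ → ℝ := fun z => evenStep (1 / 3) z.1 * evenStep (1 / 3) z.2 with hg'
  have hgm : g ∈ symmetricPerturbations := evenStep_mul_mem hq
  have hgm' : g' ∈ symmetricPerturbations := evenStep_mul_mem ht
  -- The system is regular: up to a common factor, its two columns have the ratios `1225 / 256` and
  -- `1175 / 243`.
  obtain ⟨a, b, h1, h2⟩ : ∃ a b : ℝ,
      a * ((1 / 6) ^ 2 * (27 / 512)) + b * ((1 / 6) ^ 2 * (8 / 243)) = w 0 ∧
      a * ((1 / 120) ^ 2 * (33075 / 131072)) + b * ((1 / 120) ^ 2 * (9400 / 59049)) = w 1 :=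
    exists_solution_of_det_ne_zero (by norm_num) _ _
  refine ⟨a • g + b • g', add_mem (Submodule.smul_mem _ a hgm) (Submodule.smul_mem _ b hgm'), ?_⟩
  have hval : ∀ {k : ℕ} (p : Equiv.Perm (Fin k)), firstVariation p (a • g + b • g') =
      a * firstVariation p g + b * firstVariation p g' := fun p => by
    rw [firstVariation_add p (balanced.smul_mem a hgm.1) (balanced.smul_mem b hgm'.1),
      firstVariation_smul, firstVariation_smul]
  intro i
  fin_cases i
  · change firstVariation (1 : Equiv.Perm (Fin 3)) _ = w 0
    rw [hval, hg, hg', firstVariation_one_three_quarter, firstVariation_one_three_third, h1]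
  · change firstVariation (1 : Equiv.Perm (Fin 5)) _ = w 1
    rw [hval, hg, hg', firstVariation_one_five_quarter, firstVariation_one_five_third, h2]

/-- Patterns of order at most three do not force quasirandomness: for a density with all symmetries
of the square, their probabilities are determined by that of `123`. -/
theorem not_forcing_of_order_le_three {S : Finset FinPerm} (hS : ∀ p ∈ S, p.1 ≤ 3) :
    ¬ FinPerm.Forcing (S : Set FinPerm) := by
  classical
  obtain ⟨h, ⟨hh, hrefl, hswap⟩, hpos, η, hη, hval⟩ := exists_perturbation symmetricPerturbations
    (fun h hh => hh.1) _ firstVariation_surjective_symmetric ![0, 1]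
  have h123 : patternIntegral (1 : Equiv.Perm (Fin 3)) (fun z => 1 + h z) = 1 / 36 := by
    have := hval 0
    simp only [patternIntegral_one] at this
    refine this.trans ?_
    norm_num [Nat.factorial]
  have hrev : ∀ {k : ℕ} (p : Equiv.Perm (Fin k)), patternIntegral (p * Fin.revPerm)
      (fun z => 1 + h z) = patternIntegral p fun z => 1 + h z := fun p =>
    patternIntegral_mul_rev p fun x y => by rw [hrefl]
  have hinv : ∀ {k : ℕ} (p : Equiv.Perm (Fin k)), patternIntegral p⁻¹
      (fun z => 1 + h z) = patternIntegral p fun z => 1 + h z := fun p =>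
    patternIntegral_inv p fun x y => by rw [hswap]
  have h2 : ∀ p : Equiv.Perm (Fin 2), patternIntegral p (fun z => 1 + h z) = 1 / 4 := by
    have h3 := patternIntegral_one_add_swap hh
    have h4 := hrev (1 : Equiv.Perm (Fin 2))
    have h5 : (1 : Equiv.Perm (Fin 2)) * Fin.revPerm = Equiv.swap 0 1 := by decide
    rw [h5] at h4
    have h6 : ∀ p : Equiv.Perm (Fin 2), p = 1 ∨ p = Equiv.swap 0 1 := by decide
    intro p
    rcases h6 p with rfl | rfl <;> linarith
  have h3 : ∀ p : Equiv.Perm (Fin 3), patternIntegral p (fun z => 1 + h z) = 1 / 36 := by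
    let c : Equiv.Perm (Fin 3) := Equiv.swap 1 2
    have hsum := sum_patternIntegral hh 3
    have huniv : (Finset.univ : Finset (Equiv.Perm (Fin 3))) = {1, 1 * Fin.revPerm, c,
      c * Fin.revPerm, (c * Fin.revPerm)⁻¹, (c * Fin.revPerm)⁻¹ * Fin.revPerm} := by decide
    rw [huniv, Finset.sum_insert (by decide), Finset.sum_insert (by decide),
      Finset.sum_insert (by decide), Finset.sum_insert (by decide), Finset.sum_pair (by decide)]
      at hsum
    simp only [hrev, hinv, h123] at hsum
    have hc : patternIntegral c (fun z => 1 + h z) = 1 / 36 := by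
      norm_num [Nat.factorial] at hsum
      linarith
    intro p
    have hp : p ∈ (Finset.univ : Finset (Equiv.Perm (Fin 3))) := Finset.mem_univ p
    rw [huniv] at hp
    simp only [Finset.mem_insert, Finset.mem_singleton] at hp
    rcases hp with rfl | rfl | rfl | rfl | rfl | rfl <;> simp only [hrev, hinv, h123, hc]
  refine not_forcing_of_density hh hpos S ?_ ⟨5, 1⟩ ?_
  · rintro ⟨k, p⟩ hp
    have hk := hS _ hp
    simp only at hk
    rcases Nat.lt_or_ge k 2 with hk2 | hk2
    · exact patternIntegral_of_order_le_one hh (p := ⟨k, p⟩) (Nat.le_of_lt_succ hk2)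
    · have hk' : k = 2 ∨ k = 3 := by omega
      rcases hk' with rfl | rfl
      · rw [h2]
        norm_num [Nat.factorial]
      · rw [h3]
        norm_num [Nat.factorial]
  · have := hval 1
    simp only [patternIntegral_one] at this
    intro h0
    have h4 := h0.symm.trans this
    have h5 : η = 0 := by
      simpa using h4
    exact hη h5

/-! ### The lower bound -/

theorem theorem1 (S : Set FinPerm) (hS : FinPerm.Forcing S) : 4 ≤ S.encard := by
  classical
  by_contra hlt
  have hlt' : S.encard < 4 := not_le.1 hlt
  have hfin : S.Finite := Set.finite_of_encard_le_coe (k := 4) hlt'.le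
  obtain ⟨T, rfl⟩ := hfin.exists_finset_coe
  rw [Set.encard_coe_eq_coe_finsetCard] at hlt'
  have hcard : T.card ≤ 3 := Nat.le_of_lt_succ (by exact_mod_cast hlt')
  by_cases h4 : ∃ p ∈ T, 4 ≤ p.1
  · exact not_forcing_of_four_le_order hcard h4 hS
  · push Not at h4
    exact not_forcing_of_order_le_three (fun p hp => Nat.le_of_lt_succ (h4 p hp)) hS
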